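/- Let $T$ be a finite group, let $\widehat T$ be the set of equivalence classes of its irreducible complex representations, and let $n\ge 1$ be an integer. For $m\ge 0$ let $\mathbb Y_m(\widehat T)$ be the set of families $\lambda=(\lambda^\zeta)_{\zeta\in\widehat T}$ of Young diagrams with $\sum_\zeta|\lambda^\zeta|=m$, where $|\cdot|$ is the number of boxes, and put $$\dim\lambda=\frac{m!}{\prod_{\zeta}|\lambda^\zeta|!}\prod_{\zeta}(\dim\zeta)^{|\lambda^\zeta|}\dim\lambda^\zeta ,\qquad \lambda\in\mathbb Y_m(\widehat T),$$ where $\dim\lambda^\zeta$ is the dimension of the irreducible representation of the symmetric group $\mathfrak S_{|\lambda^\zeta|}$ labelled by $\lambda^\zeta$, i.e. the number of standard Young tableaux of shape $\lambda^\zeta$; thus $\dim\lambda$ is the dimension of the irreducible representation of the wreath product $T\wr\mathfrak S_m$ labelled by $\lambda$. For $\nu\in\mathbb Y_{n-1}(\widehat T)$ and $\lambda\in\mathbb Y_n(\widehat T)$ write $\nu\nearrow\lambda$ if $\lambda$ is obtained by adding a box to one entry of $\nu$, and let $\zeta_{\nu\lambda}\in\widehat T$ be the label of that entry. The Res-Ind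 chain on $\mathbb Y_n(\widehat T)$ is the Markov chain with transition matrix $P^{(n)}=P^\downarrow P^\uparrow$, where $$P^\downarrow_{\lambda\nu}=\frac{\dim\zeta_{\nu\lambda}\,\dim\nu}{\dim\lambda},\qquad P^\uparrow_{\nu\mu}=\frac{\dim\zeta_{\nu\mu}\,\dim\mu}{n\,|T|\,\dim\nu}\qquad(\nu\nearrow\lambda,\ \nu\nearrow\mu),$$ and all other entries are $0$. Let $(Z^{(n)}_k)_{k\ge0}$ be this chain with an arbitrary initial distribution, let $\psi$ be a probability on $(0,\infty)$, and let $\epsilon_1,\epsilon_2,\dots$ be IID random variables with law $\psi$, such that the sequence $(\epsilon_j)$ is independent of the chain. For $s\ge 0$ let $N_s=j$ if $\epsilon_1+\cdots+\epsilon_j\le s<\epsilon_1+\cdots+\epsilon_{j+1}$ ($j\ge 0$), which defines $N_s$ almost surely, and let $X^{(n)}_s=Z^{(n)}_{N_s}$. Put $$a(1,n,s)=\sum_{j=0}^\infty\Bigl(1-\frac1n\Bigr)^j\int_{[0,s]}\psi\bigl((s-u,\infty)\bigr)\,\psi^{*j}(du),$$ where $\psi^{*j}$ is the $j$th convolution power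 of $\psi$, $\psi^{*0}=\delta_0$, and $0^0=1$. Then for all $s\ge 0$ and $\zeta\in\widehat T$ $$\mathbb E\Bigl[\frac{|X_s^{(n)\zeta}|}{n}\Bigr]=\bigl(1-a(1,n,s)\bigr)\frac{(\dim\zeta)^2}{|T|}+a(1,n,s)\,\mathbb E\Bigl[\frac{|X_0^{(n)\zeta}|}{n}\Bigr].$$ -/

import Mathlib

open MeasureTheory ProbabilityTheory

namespace ResInd

/-! ### Irreducible representations of a finite group -/

section Irreps

universe v

/-- Isomorphism of irreducible finite-dimensional complex representations of `T`. -/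
def irrepSetoid (T : Type v) [Group T] :
    Setoid {V : FDRep ℂ T // CategoryTheory.Simple V} where
  r V W := Nonempty (V.1 ≅ W.1)
  iseqv :=
    { refl := fun V => ⟨CategoryTheory.Iso.refl V.1⟩
      symm := fun ⟨e⟩ => ⟨e.symm⟩
      trans := fun ⟨e⟩ ⟨f⟩ => ⟨e.trans f⟩ }

/-- The dual `T̂`: equivalence classes of irreducible complex representations of `T`. -/
def Irr (T : Type v) [Group T] : Type (max 1 v) :=
  Quotient (irrepSetoid T)

/-- A representative of an equivalence class of irreducible representations. -/
noncomputable def Irr.rep {T : Type v} [Group T] (ζ : Irr T) : FDRep ℂ T :=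
  (Quotient.out ζ).1

/-- `dim ζ`, the dimension of an irreducible representation of class `ζ`. -/
noncomputable def Irr.dim {T : Type v} [Group T] (ζ : Irr T) : ℕ :=
  Module.finrank ℂ ζ.rep

instance {T : Type v} [Group T] (ζ : Irr T) : CategoryTheory.Simple ζ.rep :=
  (Quotient.out ζ).2

theorem Irr.eq_of_iso {T : Type v} [Group T] {ζ η : Irr T} (h : Nonempty (ζ.rep ≅ η.rep)) :
    ζ = η := by
  have h2 : (irrepSetoid T).r (Quotient.out ζ) (Quotient.out η) := h
  have h3 := Quotient.sound (s := irrepSetoid T) h2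
  exact (Quotient.out_eq (s := irrepSetoid T) ζ).symm.trans
    (h3.trans (Quotient.out_eq (s := irrepSetoid T) η))

/-- `T̂` is finite, since distinct irreducible characters are linearly independent. -/
instance Irr.instFinite (T : Type v) [Group T] [Finite T] : Finite (Irr T) := by
  classical
  have : Fintype T := Fintype.ofFinite T
  have hne : (Nat.card T : ℂ) ≠ 0 := by exact_mod_cast Nat.card_pos.ne'
  have : Invertible (Nat.card T : ℂ) := invertibleOfNonzero hne
  have hli : LinearIndependent ℂ (fun ζ : Irr T => (ζ.rep.character : T → ℂ)) := by
    rw [linearIndependent_iff']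
    intro s c hc η hη
    have key : ∀ g : T, ∑ ζ ∈ s, c ζ * ζ.rep.character g = 0 := by
      intro g
      have := congrFun hc g
      simpa [Finset.sum_apply] using this
    have h1 : ∑ ζ ∈ s, c ζ *
        ((Nat.card T : ℂ)⁻¹ * ∑ g : T, ζ.rep.character g * η.rep.character g⁻¹) = 0 := by
      calc _ = (Nat.card T : ℂ)⁻¹ * ∑ g : T,
            (∑ ζ ∈ s, c ζ * ζ.rep.character g) * η.rep.character g⁻¹ := by
              simp only [Finset.mul_sum, Finset.sum_mul]
              rw [Finset.sum_comm]
              refine Finset.sum_congr rfl fun g _ => Finset.sum_congr rfl fun ζ _ => ?_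
              ring
        _ = 0 := by simp [key]
    have h2 : ∀ ζ ∈ s, c ζ *
        ((Nat.card T : ℂ)⁻¹ * ∑ g : T, ζ.rep.character g * η.rep.character g⁻¹)
          = if ζ = η then c ζ else 0 := by
      intro ζ _
      rw [FDRep.char_orthonormal]
      by_cases h : ζ = η
      · subst h
        simp [show Nonempty (ζ.rep ≅ ζ.rep) from ⟨CategoryTheory.Iso.refl _⟩]
      · have : ¬ Nonempty (ζ.rep ≅ η.rep) := fun h' => h (Irr.eq_of_iso h')
        simp [h, this]
    rw [Finset.sum_congr rfl h2] at h1
    simpa [hη] using h1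
  exact hli.finite

noncomputable instance Irr.instFintype (T : Type v) [Group T] [Finite T] : Fintype (Irr T) :=
  Fintype.ofFinite _

end Irreps

/-! ### Young diagrams and multi-Young diagrams -/

/-- A standard Young tableau of shape `ν`: a numbering of the boxes of `ν` by
`0, …, |ν| - 1`, each number used once, that increases along rows and columns
(i.e. is monotone for the product order on the boxes). -/
def StandardTableau (ν : YoungDiagram) : Type :=
  {e : ν.cells ≃ Fin ν.card // Monotone e}

/-- `dim ν`: the dimension of the irreducible representation of the symmetric group of degree
`|ν|` with label `ν`, that is, the number of standard Young tableaux of shape `ν` (which index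
the basis in Young's orthogonal form), equivalently the number of paths from `∅` to `ν` in the
Young graph. -/
noncomputable def youngDim (ν : YoungDiagram) : ℕ :=
  Nat.card (StandardTableau ν)

section Chain

variable {T : Type*} [Group T] [Finite T]

/-- `𝕐ₙ(T̂)`: families of Young diagrams indexed by `T̂` with `n` boxes in total. -/
def MultiDiagram (T : Type*) [Group T] [Finite T] (n : ℕ) : Type _ :=
  {l : Irr T → YoungDiagram // ∑ ζ, (l ζ).card = n}

/-- `|λ^ζ|`, the number of boxes of the entry of `λ` with label `ζ`. -/
def MultiDiagram.size {n : ℕ} (l : MultiDiagram T n) (ζ : Irr T) : ℕ :=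
  (l.1 ζ).card

theorem finite_youngDiagram_card_le (n : ℕ) : {ν : YoungDiagram | ν.card ≤ n}.Finite := by
  have hinj : Function.Injective YoungDiagram.cells := fun a b h => YoungDiagram.ext h
  refine Set.Finite.of_finite_image (f := YoungDiagram.cells) ?_ hinj.injOn
  refine (Finset.finite_toSet (Finset.range n ×ˢ Finset.range n).powerset).subset ?_
  rintro _ ⟨ν, hν, rfl⟩
  simp only [Finset.coe_powerset, Set.mem_preimage, Set.mem_powerset_iff, Finset.coe_subset]
  rintro ⟨i, j⟩ hij
  have hν' : ν.card ≤ n := hν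
  have h1 : i + 1 ≤ ν.card := by
    have : (Finset.range (i + 1)).image (fun a => (a, j)) ⊆ ν.cells := by
      intro c hc
      obtain ⟨a, ha, rfl⟩ := Finset.mem_image.1 hc
      exact ν.up_left_mem (Nat.lt_succ_iff.1 (Finset.mem_range.1 ha)) le_rfl hij
    have h := Finset.card_le_card this
    rwa [Finset.card_image_of_injective _ (fun a b h => (Prod.mk.inj h).1),
      Finset.card_range] at h
  have h2 : j + 1 ≤ ν.card := by
    have : (Finset.range (j + 1)).image (fun a => (i, a)) ⊆ ν.cells := by
      intro c hc
      obtain ⟨a, ha, rfl⟩ := Finset.mem_image.1 hc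
      exact ν.up_left_mem le_rfl (Nat.lt_succ_iff.1 (Finset.mem_range.1 ha)) hij
    have h := Finset.card_le_card this
    rwa [Finset.card_image_of_injective _ (fun a b h => (Prod.mk.inj h).2),
      Finset.card_range] at h
  simp only [Finset.mem_product, Finset.mem_range]
  omega

instance MultiDiagram.instFinite (n : ℕ) : Finite (MultiDiagram T n) := by
  have := (finite_youngDiagram_card_le n).to_subtype
  refine Finite.of_injective
    (β := Irr T → {ν : YoungDiagram | ν.card ≤ n})
    (fun l ζ => ⟨l.1 ζ, ?_⟩) ?_
  · have h := Finset.single_le_sum (f := fun ζ => (l.1 ζ).card)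
      (fun _ _ => Nat.zero_le _) (Finset.mem_univ ζ)
    exact h.trans l.2.le
  · intro a b h
    apply Subtype.ext
    funext ζ
    exact congrArg Subtype.val (congrFun h ζ)

noncomputable instance MultiDiagram.instFintype (n : ℕ) : Fintype (MultiDiagram T n) :=
  Fintype.ofFinite _

/-- Every subset of the finite state space `𝕐ₙ(T̂)` is measurable. -/
instance MultiDiagram.instMeasurableSpace (n : ℕ) : MeasurableSpace (MultiDiagram T n) := ⊤

/-- `dim λ` for `λ ∈ 𝕐ₙ(T̂)`: the dimension
`n! / ∏_ζ |λ^ζ|! * ∏_ζ (dim ζ)^|λ^ζ| dim λ^ζ` of the irreducible representation of the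
wreath product `T ≀ 𝔖ₙ` with label `λ`. -/
noncomputable def MultiDiagram.dim {n : ℕ} (l : MultiDiagram T n) : ℝ :=
  (n.factorial : ℝ) / (∏ ζ, ((l.size ζ).factorial : ℝ)) *
    ∏ ζ, ((ζ.dim : ℝ) ^ l.size ζ * (youngDim (l.1 ζ) : ℝ))

/-- `ν ↗ λ` with `ζ_{νλ} = ζ`: the multi-diagram `λ` is obtained from `ν` by adding one box
at the entry with label `ζ`. -/
def AddsBoxAt {m n : ℕ} (v : MultiDiagram T m) (l : MultiDiagram T n) (ζ : Irr T) : Prop :=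
  v.1 ζ ≤ l.1 ζ ∧ (l.1 ζ).card = (v.1 ζ).card + 1 ∧ ∀ η, η ≠ ζ → l.1 η = v.1 η

open Classical in
/-- The multiplicity of the edge between `ν` and `λ` in the branching graph: `dim ζ_{νλ}` if
`ν ↗ λ`, and `0` otherwise (the label `ζ_{νλ}` is unique, so at most one term is nonzero). -/
noncomputable def branchMult {m n : ℕ} (v : MultiDiagram T m) (l : MultiDiagram T n) : ℝ :=
  ∑ ζ, if AddsBoxAt v l ζ then (ζ.dim : ℝ) else 0

variable (T) in
/-- The restriction matrix `P↓`, with entries `dim ζ_{νλ} dim ν / dim λ` for `ν ↗ λ`. -/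
noncomputable def PDown (n : ℕ) : Matrix (MultiDiagram T n) (MultiDiagram T (n - 1)) ℝ :=
  fun l v => branchMult v l * v.dim / l.dim

variable (T) in
/-- The induction matrix `P↑`, with entries `dim ζ_{νμ} dim μ / (n |T| dim ν)` for `ν ↗ μ`. -/
noncomputable def PUp (n : ℕ) : Matrix (MultiDiagram T (n - 1)) (MultiDiagram T n) ℝ :=
  fun v m => branchMult v m * m.dim / ((n : ℝ) * (Nat.card T : ℝ) * v.dim)

variable (T) in
/-- The transition matrix `P = P↓ P↑` of the Res-Ind chain on `𝕐ₙ(T̂)`, for `n ≥ 1`. -/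
noncomputable def P (n : ℕ) : Matrix (MultiDiagram T n) (MultiDiagram T n) ℝ :=
  PDown T n * PUp T n

end Chain

/-! ### The processes -/

/-- `Z` is a (time-homogeneous) Markov chain with transition matrix `Q` and arbitrary initial
distribution, on the probability space `(Ω, Pr)`. -/
structure IsMarkovChain {S Ω : Type*} [MeasurableSpace S] [MeasurableSpace Ω]
    (Pr : Measure Ω) (Q : Matrix S S ℝ) (Z : ℕ → Ω → S) : Prop where
  measurable : ∀ k, Measurable (Z k)
  law : ∀ (k : ℕ) (z : ℕ → S),
    Pr.real {ω | ∀ i ≤ k, Z i ω = z i} =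
      Pr.real {ω | Z 0 ω = z 0} * ∏ i ∈ Finset.range k, Q (z i) (z (i + 1))

/-- The counting process of the pausing times `ε 0, ε 1, …`: the number `N_s` is the `j` with
`ε 0 + ⋯ + ε (j - 1) ≤ s < ε 0 + ⋯ + ε j` (unique for positive pausing times with infinite sum
and `s ≥ 0`), written as the least `j` for which the second inequality holds. -/
noncomputable def counting {Ω : Type*} (ε : ℕ → Ω → ℝ) (s : ℝ) (ω : Ω) : ℕ :=
  sInf {j : ℕ | s < ∑ i ∈ Finset.range (j + 1), ε i ω}

/-- The continuous-time process `X_s = Z_{N_s}`. -/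
noncomputable def process {S Ω : Type*} (Z : ℕ → Ω → S) (ε : ℕ → Ω → ℝ) (s : ℝ) (ω : Ω) : S :=
  Z (counting ε s ω) ω

/-- The `j`-th convolution power `ψ^{*j}`, with `ψ^{*0}` the unit mass at `0`. -/
noncomputable def convPower (ψ : Measure ℝ) : ℕ → Measure ℝ
  | 0 => Measure.dirac 0
  | j + 1 => convPower ψ j ∗ ψ

/-- `a(k,n,s) = ∑_{j ≥ 0} (1 - k/n)^j ∫_{[0,s]} ψ((s-u,∞)) ψ^{*j}(du)`. -/
noncomputable def a (ψ : Measure ℝ) (k n : ℕ) (s : ℝ) : ℝ :=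
  ∑' j : ℕ, (1 - (k : ℝ) / (n : ℝ)) ^ j *
    ∫ u in Set.Icc 0 s, ψ.real (Set.Ioi (s - u)) ∂(convPower ψ j)

end ResInd

/-!
The relative size `|λ^ζ| / n` is, up to the constant `b = (dim ζ)² / |T|`, an eigenfunction of the
Res-Ind transition matrix with eigenvalue `q = 1 - 1 / n` (`sum_P_mul_size_div`). Indeed, a
restriction step from `λ` removes a box from the entry with label `η` with probability `|λ^η| / n`,
and an induction step adds a box to it with probability `(dim η)² / |T|`. The first fact reduces to
the branching rule of the Young graph, `youngDim_eq_sum_boxRemovals`. The second one reduces to the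
dual rule `∑_{μ ↘ ν} dim μ = (|ν| + 1) dim ν`, `sum_boxAdditions_youngDim`, proved by induction
from the commutation of going up and going down (`sum_boxAdditions_erase`) and the fact that a
diagram has one more addable box than removable ones (`card_boxAdditions`). That the induction
probabilities sum to `1` is the identity `∑_ζ (dim ζ)² = |T|` (`sum_dim_sq`): by Maschke's theorem
the regular character is a combination of irreducible ones, its coefficients are the dimensions by
orthonormality, and its value at `1` is `|T|`.

Hence the expectation of the relative size at the `j`th step of the chain is `b + q ^ j * (e - b)`,
where `e` is its initial value. Since `N_s` is independent of the chain, the expectation at time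
`s` is the mixture of these numbers with weights `Pr (N_s = j)` (`hasSum_integral_process`). The
weights sum to `1`, and they are the integrals in the definition of `a`
(`measureReal_counting_eq`), because `ε 0 + ⋯ + ε (j - 1)` has law `ψ^{*j}` and is independent of
`ε j`; here one needs that the partial sums of the pausing times are almost surely unbounded
(`ae_exists_lt_sum`). Summing over `j` gives the claim.
-/

namespace ResInd

/-! ### Standard Young tableaux and the Young graph -/

/-- `μ` is obtained from `ν` by adding one box. -/
def AddsBox (ν μ : YoungDiagram) : Prop :=
  ν ≤ μ ∧ μ.card = ν.card + 1

open Classical in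
/-- The diagrams obtained from `μ` by removing one box. -/
noncomputable def boxRemovals (μ : YoungDiagram) : Finset YoungDiagram :=
  (finite_youngDiagram_card_le μ.card).toFinset.filter fun ν => AddsBox ν μ

open Classical in
/-- The diagrams obtained from `ν` by adding one box. -/
noncomputable def boxAdditions (ν : YoungDiagram) : Finset YoungDiagram :=
  (finite_youngDiagram_card_le (ν.card + 1)).toFinset.filter fun μ => AddsBox ν μ

@[simp]
theorem mem_boxRemovals {ν μ : YoungDiagram} : ν ∈ boxRemovals μ ↔ AddsBox ν μ := by
  simp only [boxRemovals, Finset.mem_filter, Set.Finite.mem_toFinset, Set.mem_ofPred_eq,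
    and_iff_right_iff_imp]
  intro h
  have := h.2
  omega

@[simp]
theorem mem_boxAdditions {ν μ : YoungDiagram} : μ ∈ boxAdditions ν ↔ AddsBox ν μ := by
  simp only [boxAdditions, Finset.mem_filter, Set.Finite.mem_toFinset, Set.mem_ofPred_eq,
    and_iff_right_iff_imp]
  intro h
  exact h.2.le

theorem AddsBox.exists_cell {ν μ : YoungDiagram} (h : AddsBox ν μ) :
    ∃ c, c ∉ ν ∧ μ.cells = insert c ν.cells := by
  have h1 : (μ.cells \ ν.cells).card = 1 := by
    rw [Finset.card_sdiff_of_subset h.1]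
    have := h.2
    unfold YoungDiagram.card at this
    omega
  obtain ⟨c, hc⟩ := Finset.card_eq_one.1 h1
  have hmem : c ∈ μ.cells \ ν.cells := by simp [hc]
  refine ⟨c, (Finset.mem_sdiff.1 hmem).2, ?_⟩
  rw [← Finset.sdiff_union_of_subset (show ν.cells ⊆ μ.cells from h.1), hc]
  rfl

theorem AddsBox.of_cells_eq_insert {ν μ : YoungDiagram} {c : ℕ × ℕ} (hc : c ∉ ν)
    (h : μ.cells = insert c ν.cells) : AddsBox ν μ := by
  refine ⟨YoungDiagram.cells_subset_iff.1 (h ▸ Finset.subset_insert _ _), ?_⟩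
  rw [YoungDiagram.card, h, Finset.card_insert_of_notMem hc]

/-- The numberings of the boxes of `μ` that are standard Young tableaux, extended by `0` to all
of `ℕ × ℕ`. In contrast to `StandardTableau`, the type of values does not depend on `μ`. -/
def standardNumberings (μ : YoungDiagram) : Set (ℕ × ℕ → ℕ) :=
  {g | (∀ c ∉ μ, g c = 0) ∧ (∀ c ∈ μ, g c < μ.card) ∧
    (∀ c ∈ μ, ∀ d ∈ μ, g c = g d → c = d) ∧ ∀ c ∈ μ, ∀ d ∈ μ, c ≤ d → g c ≤ g d}

theorem exists_of_mem_standardNumberings {μ : YoungDiagram} {g : ℕ × ℕ → ℕ}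
    (hg : g ∈ standardNumberings μ) {k : ℕ} (hk : k < μ.card) : ∃ c ∈ μ, g c = k := by
  have himg : μ.cells.image g = Finset.range μ.card := by
    refine Finset.eq_of_subset_of_card_le ?_ ?_
    · intro x hx
      obtain ⟨c, hc, rfl⟩ := Finset.mem_image.1 hx
      exact Finset.mem_range.2 (hg.2.1 c hc)
    · rw [Finset.card_range, Finset.card_image_of_injOn]
      exact fun c hc d hd h => hg.2.2.1 c hc d hd h
  have : k ∈ μ.cells.image g := himg ▸ Finset.mem_range.2 hk
  simpa using this

open Classical in
/-- Standard tableaux are the same as standard numberings. -/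
noncomputable def standardTableauEquiv (μ : YoungDiagram) :
    StandardTableau μ ≃ standardNumberings μ :=
  Equiv.ofBijective
    (fun e => ⟨fun c => if h : c ∈ μ.cells then (e.1 ⟨c, h⟩ : ℕ) else 0, by
      refine ⟨fun c hc => dif_neg hc, fun c hc => ?_, fun c hc d hd h => ?_,
        fun c hc d hd h => ?_⟩
      · have hc' : c ∈ μ.cells := hc
        simp only [hc', dif_pos, Fin.is_lt]
      · have hc' : c ∈ μ.cells := hc
        have hd' : d ∈ μ.cells := hd
        simp only [hc', hd', dif_pos] at h
        exact congrArg Subtype.val (e.1.injective (Fin.ext h))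
      · have hc' : c ∈ μ.cells := hc
        have hd' : d ∈ μ.cells := hd
        simp only [hc', hd', dif_pos]
        exact e.2 (show (⟨c, hc'⟩ : μ.cells) ≤ ⟨d, hd'⟩ from h)⟩)
    (by
      constructor
      · intro e e' h
        apply Subtype.ext
        apply Equiv.ext
        rintro ⟨c, hc⟩
        have := congrFun (congrArg Subtype.val h) c
        simp only [hc, dif_pos] at this
        exact Fin.ext this
      · rintro ⟨g, hg⟩
        have hbij : Function.Bijective
            (fun c : μ.cells => (⟨g c.1, hg.2.1 c.1 c.2⟩ : Fin μ.card)) := by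
          rw [Fintype.bijective_iff_injective_and_card]
          refine ⟨fun c d h => Subtype.ext (hg.2.2.1 c.1 c.2 d.1 d.2 (Fin.mk.inj h)), ?_⟩
          simp [YoungDiagram.card]
        refine ⟨⟨Equiv.ofBijective _ hbij, fun c d h => hg.2.2.2 c.1 c.2 d.1 d.2 h⟩, ?_⟩
        apply Subtype.ext
        funext c
        by_cases hc : c ∈ μ.cells
        · simp [hc]
        · simpa [hc] using (hg.1 c hc).symm)

theorem youngDim_eq_card_standardNumberings (μ : YoungDiagram) :
    youngDim μ = Nat.card (standardNumberings μ) :=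
  Nat.card_congr (standardTableauEquiv μ)

instance finite_standardNumberings (μ : YoungDiagram) : Finite (standardNumberings μ) := by
  have : Finite (StandardTableau μ) :=
    inferInstanceAs (Finite {e : μ.cells ≃ Fin μ.card // Monotone e})
  exact Finite.of_equiv _ (standardTableauEquiv μ)

open Classical in
theorem extend_mem_standardNumberings {ν μ : YoungDiagram} (h : AddsBox ν μ)
    {g : ℕ × ℕ → ℕ} (hg : g ∈ standardNumberings ν) :
    (fun c => if c ∈ ν then g c else if c ∈ μ then ν.card else 0) ∈ standardNumberings μ := by
  obtain ⟨b, hb, hcells⟩ := h.exists_cell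
  have hmem : ∀ c, c ∈ μ ↔ c = b ∨ c ∈ ν := fun c => by
    rw [← YoungDiagram.mem_cells, hcells, Finset.mem_insert, YoungDiagram.mem_cells]
  have hbμ : b ∈ μ := (hmem b).2 (Or.inl rfl)
  have hcard := h.2
  refine ⟨fun c hc => ?_, fun c hc => ?_, fun c hc d hd hcd => ?_, fun c hc d hd hcd => ?_⟩
  · have : c ∉ ν := fun h' => hc ((hmem c).2 (Or.inr h'))
    simp [hc, this]
  · rcases (hmem c).1 hc with rfl | h'
    · simp [hb, hc]; omega
    · have := hg.2.1 c h'
      simp [h']; omega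
  · rcases (hmem c).1 hc with rfl | hc' <;> rcases (hmem d).1 hd with rfl | hd'
    · rfl
    · have := hg.2.1 d hd'
      simp [hb, hc, hd'] at hcd; omega
    · have := hg.2.1 c hc'
      simp [hb, hd, hc'] at hcd; omega
    · simp [hc', hd'] at hcd
      exact hg.2.2.1 c hc' d hd' hcd
  · rcases (hmem c).1 hc with rfl | hc' <;> rcases (hmem d).1 hd with rfl | hd'
    · rfl
    · exact absurd (ν.isLowerSet hcd hd') hb
    · have := hg.2.1 c hc'
      simp [hb, hd, hc']; omega
    · simp [hc', hd']
      exact hg.2.2.2 c hc' d hd' hcd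

/-- The diagram formed by the boxes of a standard tableau that carry numbers below `m`. -/
def dropLast {μ : YoungDiagram} {g : ℕ × ℕ → ℕ} (hg : g ∈ standardNumberings μ) (m : ℕ) :
    YoungDiagram where
  cells := μ.cells.filter fun c => g c < m
  isLowerSet := by
    intro c d hdc hc
    simp only [Finset.coe_filter, YoungDiagram.mem_cells, Set.mem_ofPred_eq] at hc ⊢
    have hd := μ.isLowerSet hdc hc.1
    exact ⟨hd, (hg.2.2.2 d hd c hc.1 hdc).trans_lt hc.2⟩

theorem mem_dropLast {μ : YoungDiagram} {g : ℕ × ℕ → ℕ} (hg : g ∈ standardNumberings μ)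
    {m : ℕ} {c : ℕ × ℕ} : c ∈ dropLast hg m ↔ c ∈ μ ∧ g c < m := by
  rw [← YoungDiagram.mem_cells]
  simp [dropLast]

theorem addsBox_dropLast {μ : YoungDiagram} {g : ℕ × ℕ → ℕ} (hg : g ∈ standardNumberings μ)
    {m : ℕ} (hm : μ.card = m + 1) : AddsBox (dropLast hg m) μ := by
  obtain ⟨b, hb, hgb⟩ := exists_of_mem_standardNumberings hg (k := m) (by omega)
  refine AddsBox.of_cells_eq_insert (c := b) (by simp [mem_dropLast, hgb]) ?_
  ext c
  rw [Finset.mem_insert, YoungDiagram.mem_cells, YoungDiagram.mem_cells, mem_dropLast]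
  constructor
  · intro hc
    have := hg.2.1 c hc
    by_cases h : g c = m
    · exact Or.inl (hg.2.2.1 c hc b hb (h.trans hgb.symm))
    · exact Or.inr ⟨hc, by omega⟩
  · rintro (rfl | h)
    exacts [hb, h.1]

/-- Branching rule of the Young graph: a standard tableau is determined by the position of the
largest number and the tableau of the remaining numbers. -/
theorem youngDim_eq_sum_boxRemovals {μ : YoungDiagram} (hμ : μ.card ≠ 0) :
    youngDim μ = ∑ ν ∈ boxRemovals μ, youngDim ν := by
  classical
  obtain ⟨m, hm⟩ := Nat.exists_eq_succ_of_ne_zero hμ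
  have hbij : Function.Bijective
      (fun x : Σ ν : boxRemovals μ, standardNumberings ν.1 =>
        (⟨_, extend_mem_standardNumberings (mem_boxRemovals.1 x.1.2) x.2.2⟩ :
          standardNumberings μ)) := by
    constructor
    · rintro ⟨⟨ν, hν⟩, g, hg⟩ ⟨⟨κ, hκ⟩, k, hk⟩ h
      have h' := congrFun (congrArg Subtype.val h)
      simp only at h'
      have hν' := mem_boxRemovals.1 hν
      have hκ' := mem_boxRemovals.1 hκ
      have hνm : ν.card = m := by have := hν'.2; omega
      have hκm : κ.card = m := by have := hκ'.2; omega
      have hcells : ∀ c, c ∈ ν ↔ c ∈ κ := by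
        intro c
        have hc := h' c
        constructor
        · intro h1
          by_contra h2
          have : g c < ν.card := hg.2.1 c h1
          have h3 : c ∈ μ := hν'.1 h1
          simp only [h1, h2, h3, if_true, if_false] at hc
          omega
        · intro h1
          by_contra h2
          have : k c < κ.card := hk.2.1 c h1
          have h3 : c ∈ μ := hκ'.1 h1
          simp only [h1, h2, h3, if_true, if_false] at hc
          omega
      obtain rfl : ν = κ := SetLike.ext hcells
      obtain rfl : g = k := by
        funext c
        by_cases hc : c ∈ ν
        · simpa [hc] using h' c
        · rw [hg.1 c hc, hk.1 c hc]
      rfl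
    · rintro ⟨g, hg⟩
      have hadd := addsBox_dropLast hg hm
      have hcard : (dropLast hg m).card = m := by have := hadd.2; omega
      refine ⟨⟨⟨dropLast hg m, mem_boxRemovals.2 hadd⟩,
        fun c => if c ∈ dropLast hg m then g c else 0, ?_⟩, ?_⟩
      · refine ⟨fun c hc => if_neg hc, fun c hc => ?_, fun c hc d hd h => ?_,
          fun c hc d hd h => ?_⟩
        · simpa [hc, hcard] using ((mem_dropLast hg).1 hc).2
        · simp only [hc, hd, if_true] at h
          exact hg.2.2.1 c (hadd.1 hc) d (hadd.1 hd) h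
        · simpa only [hc, hd, if_true] using hg.2.2.2 c (hadd.1 hc) d (hadd.1 hd) h
      · apply Subtype.ext
        funext c
        by_cases hc : c ∈ dropLast hg m
        · simp [hc]
        · by_cases hc' : c ∈ μ
          · have h1 := hg.2.1 c hc'
            have h2 : ¬ g c < m := fun h => hc ((mem_dropLast hg).2 ⟨hc', h⟩)
            simp only [hc, hc', hcard, if_true, if_false]
            omega
          · simp [hc, hc', hg.1 c hc']
  rw [youngDim_eq_card_standardNumberings, ← Nat.card_congr (Equiv.ofBijective _ hbij),
    Nat.card_sigma, ← Finset.sum_coe_sort (boxRemovals μ)]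
  exact Finset.sum_congr rfl fun ν _ => (youngDim_eq_card_standardNumberings ν.1).symm

theorem boxRemovals_nonempty {μ : YoungDiagram} (hμ : μ.card ≠ 0) : (boxRemovals μ).Nonempty := by
  obtain ⟨c, hc⟩ := μ.cells.exists_maximal (Finset.card_ne_zero.1 hμ)
  refine ⟨⟨μ.cells.erase c, ?_⟩, mem_boxRemovals.2 (AddsBox.of_cells_eq_insert (c := c) ?_ ?_)⟩
  · intro a b hba ha
    simp only [Finset.coe_erase, Set.mem_sdiff, Finset.mem_coe, Set.mem_singleton_iff] at ha ⊢
    refine ⟨μ.isLowerSet hba ha.1, ?_⟩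
    rintro rfl
    exact ha.2 (le_antisymm (hc.2 ha.1 hba) hba)
  · exact fun h => (Finset.mem_erase.1 h).1 rfl
  · exact (Finset.insert_erase hc.1).symm

theorem youngDim_pos (μ : YoungDiagram) : 0 < youngDim μ := by
  induction h : μ.card generalizing μ with
  | zero =>
    rw [youngDim_eq_card_standardNumberings]
    have hmem : ∀ c, c ∉ μ := fun c hc => by
      have : μ.cells = ∅ := Finset.card_eq_zero.1 h
      simp [← YoungDiagram.mem_cells, this] at hc
    have : Nonempty (standardNumberings μ) := ⟨⟨fun _ => 0, by simp [standardNumberings, hmem]⟩⟩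
    exact Nat.card_pos
  | succ m ih =>
    rw [youngDim_eq_sum_boxRemovals (by omega)]
    refine Finset.sum_pos (fun ν hν => ih ν ?_) (boxRemovals_nonempty (by omega))
    have := (mem_boxRemovals.1 hν).2
    omega

theorem card_sup_add_card_inf (ν κ : YoungDiagram) :
    (ν ⊔ κ).card + (ν ⊓ κ).card = ν.card + κ.card :=
  Finset.card_union_add_card_inter _ _

theorem eq_of_le_of_card_le {ν μ : YoungDiagram} (h : ν ≤ μ) (hc : μ.card ≤ ν.card) : ν = μ :=
  YoungDiagram.ext (Finset.eq_of_subset_of_card_le h hc)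

theorem card_lt_card_of_lt {ν μ : YoungDiagram} (h : ν < μ) : ν.card < μ.card :=
  Finset.card_lt_card h

/-- A box can be added to a row if and only if the row is the first one or strictly shorter than
the previous one. -/
theorem exists_addsBox_row_iff {ν : YoungDiagram} {i : ℕ} :
    (∃ μ : YoungDiagram, μ.cells = insert (i, ν.rowLen i) ν.cells) ↔
      i = 0 ∨ ν.rowLen i < ν.rowLen (i - 1) := by
  constructor
  · rintro ⟨μ, hμ⟩
    rcases i with _ | i
    · exact Or.inl rfl
    · right
      have h1 : (i + 1, ν.rowLen (i + 1)) ∈ μ := by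
        rw [← YoungDiagram.mem_cells, hμ]; exact Finset.mem_insert_self _ _
      have h2 := μ.up_left_mem (Nat.le_succ i) le_rfl h1
      rw [← YoungDiagram.mem_cells, hμ, Finset.mem_insert] at h2
      rcases h2 with h2 | h2
      · simp at h2
      · exact YoungDiagram.mem_iff_lt_rowLen.1 h2
  · intro h
    refine ⟨⟨insert (i, ν.rowLen i) ν.cells, ?_⟩, rfl⟩
    rintro ⟨a, b⟩ ⟨c, d⟩ ⟨hca, hdb⟩ hab
    simp only [Finset.coe_insert, Set.mem_insert_iff, Finset.mem_coe, YoungDiagram.mem_cells,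
      YoungDiagram.mem_iff_lt_rowLen, Prod.mk.injEq] at hab ⊢
    simp only at hca hdb
    rcases hab with ⟨rfl, rfl⟩ | hab
    · rcases hca.lt_or_eq with hlt | rfl
      · right
        have h1 : ν.rowLen (a - 1) ≤ ν.rowLen c := ν.rowLen_anti _ _ (by omega)
        omega
      · omega
    · right
      have h1 : ν.rowLen a ≤ ν.rowLen c := ν.rowLen_anti _ _ hca
      omega

/-- The last box of a row can be removed if and only if the row is strictly longer than the next
one. -/
theorem exists_removed_row_iff {ν : YoungDiagram} {i : ℕ} :
    (∃ κ : YoungDiagram, ν.rowLen i ≠ 0 ∧ κ.cells = ν.cells.erase (i, ν.rowLen i - 1)) ↔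
      ν.rowLen (i + 1) < ν.rowLen i := by
  constructor
  · rintro ⟨κ, hi, hκ⟩
    by_contra hlt
    have h1 : (i + 1, ν.rowLen i - 1) ∈ κ := by
      rw [← YoungDiagram.mem_cells, hκ, Finset.mem_erase]
      refine ⟨by simp, YoungDiagram.mem_iff_lt_rowLen.2 (by omega)⟩
    have h2 := κ.up_left_mem (Nat.le_succ i) le_rfl h1
    rw [← YoungDiagram.mem_cells, hκ] at h2
    simp at h2
  · intro h
    refine ⟨⟨ν.cells.erase (i, ν.rowLen i - 1), ?_⟩, by omega, rfl⟩
    rintro ⟨a, b⟩ ⟨c, d⟩ ⟨hca, hdb⟩ hab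
    simp only [Finset.coe_erase, Set.mem_sdiff, Finset.mem_coe, YoungDiagram.mem_cells,
      Set.mem_singleton_iff,
      YoungDiagram.mem_iff_lt_rowLen, Prod.mk.injEq] at hab ⊢
    simp only at hca hdb
    have h1 : ν.rowLen a ≤ ν.rowLen c := ν.rowLen_anti _ _ hca
    refine ⟨by omega, ?_⟩
    rintro ⟨rfl, rfl⟩
    rcases hca.lt_or_eq with hlt | rfl
    · have : ν.rowLen a ≤ ν.rowLen (c + 1) := ν.rowLen_anti _ _ hlt
      omega
    · omega

theorem AddsBox.exists_row {ν μ : YoungDiagram} (h : AddsBox ν μ) :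
    ∃ i, μ.cells = insert (i, ν.rowLen i) ν.cells := by
  obtain ⟨⟨i, j⟩, hc, hcells⟩ := h.exists_cell
  have hmem : (i, j) ∈ μ := by
    rw [← YoungDiagram.mem_cells, hcells]; exact Finset.mem_insert_self _ _
  have h1 : ν.rowLen i ≤ j := by
    by_contra hlt
    exact hc (YoungDiagram.mem_iff_lt_rowLen.2 (by omega))
  have h2 : (i, ν.rowLen i) ∈ μ := μ.up_left_mem le_rfl h1 hmem
  rw [← YoungDiagram.mem_cells, hcells, Finset.mem_insert] at h2
  rcases h2 with h2 | h2
  · exact ⟨i, h2 ▸ hcells⟩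
  · simp [YoungDiagram.mem_iff_lt_rowLen] at h2

theorem AddsBox.exists_removed_row {κ ν : YoungDiagram} (h : AddsBox κ ν) :
    ∃ i, ν.rowLen i ≠ 0 ∧ κ.cells = ν.cells.erase (i, ν.rowLen i - 1) := by
  obtain ⟨⟨i, j⟩, hc, hcells⟩ := h.exists_cell
  have hmem : (i, j) ∈ ν := by
    rw [← YoungDiagram.mem_cells, hcells]; exact Finset.mem_insert_self _ _
  have hj := YoungDiagram.mem_iff_lt_rowLen.1 hmem
  have h1 : (i, ν.rowLen i - 1) ∈ ν := YoungDiagram.mem_iff_lt_rowLen.2 (by omega)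
  rw [← YoungDiagram.mem_cells, hcells, Finset.mem_insert] at h1
  refine ⟨i, by omega, ?_⟩
  rcases h1 with h1 | h1
  · rw [h1, hcells, Finset.erase_insert hc]
  · exact absurd (κ.up_left_mem le_rfl (by omega) h1) hc

/-- A diagram has one more addable box than removable ones: sending a removable box to the row
below it reaches all rows with an addable box but the first. -/
theorem card_boxAdditions (ν : YoungDiagram) :
    (boxAdditions ν).card = (boxRemovals ν).card + 1 := by
  classical
  set D : Set ℕ := {i | ν.rowLen (i + 1) < ν.rowLen i} with hD
  have hinj : Function.Injective YoungDiagram.cells := fun a b h => YoungDiagram.ext h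
  have hrem : (boxRemovals ν).card = D.ncard := by
    choose! r hr using fun κ (hκ : AddsBox κ ν) => hκ.exists_removed_row
    rw [← Set.ncard_coe_finset]
    refine Set.ncard_congr (fun κ _ => r κ) (fun κ hκ => ?_) (fun κ κ' hκ hκ' h => ?_)
      fun i hi => ?_
    · exact exists_removed_row_iff.1 ⟨κ, hr κ (mem_boxRemovals.1 hκ)⟩
    · have h1 := (hr κ (mem_boxRemovals.1 hκ)).2
      rw [h, ← (hr κ' (mem_boxRemovals.1 hκ')).2] at h1
      exact hinj h1
    · obtain ⟨κ, hi0, hκ⟩ := exists_removed_row_iff.2 hi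
      have hmem : ∀ k, ν.rowLen k ≠ 0 → (k, ν.rowLen k - 1) ∈ ν.cells := fun k hk => by
        rw [YoungDiagram.mem_cells, YoungDiagram.mem_iff_lt_rowLen]; omega
      have hadd : AddsBox κ ν := AddsBox.of_cells_eq_insert (c := (i, ν.rowLen i - 1))
        (by simp [← YoungDiagram.mem_cells, hκ]) (by rw [hκ, Finset.insert_erase (hmem i hi0)])
      obtain ⟨hr0, hr1⟩ := hr κ hadd
      rw [hκ] at hr1
      have h2 := (Finset.erase_injOn ν.cells).eq_iff (hmem i hi0) (hmem _ hr0) |>.1 hr1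
      exact ⟨κ, mem_boxRemovals.2 hadd, (congrArg Prod.fst h2).symm⟩
  have hadd : (boxAdditions ν).card = (insert 0 (Nat.succ '' D)).ncard := by
    have hset : insert 0 (Nat.succ '' D) = {i | i = 0 ∨ ν.rowLen i < ν.rowLen (i - 1)} := by
      ext i
      rcases i with _ | i <;> simp [hD]
    choose! r hr using fun μ (hμ : AddsBox ν μ) => hμ.exists_row
    rw [hset, ← Set.ncard_coe_finset]
    refine Set.ncard_congr (fun μ _ => r μ) (fun μ hμ => ?_) (fun μ μ' hμ hμ' h => ?_)
      fun i hi => ?_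
    · exact exists_addsBox_row_iff.1 ⟨μ, hr μ (mem_boxAdditions.1 hμ)⟩
    · have h1 := hr μ (mem_boxAdditions.1 hμ)
      rw [h, ← hr μ' (mem_boxAdditions.1 hμ')] at h1
      exact hinj h1
    · obtain ⟨μ, hμ⟩ := exists_addsBox_row_iff.2 hi
      have hmem : (i, ν.rowLen i) ∉ ν.cells := by
        simp [YoungDiagram.mem_iff_lt_rowLen]
      have hadd : AddsBox ν μ := AddsBox.of_cells_eq_insert hmem hμ
      have hr1 := hr μ hadd
      rw [hμ] at hr1
      exact ⟨μ, mem_boxAdditions.2 hadd,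
        (congrArg Prod.fst ((Finset.insert_inj hmem).1 hr1)).symm⟩
  have hfin : D.Finite := by
    refine (Finset.finite_toSet (ν.cells.image Prod.fst)).subset fun i hi => ?_
    have : (i, 0) ∈ ν.cells := by
      rw [YoungDiagram.mem_cells, YoungDiagram.mem_iff_lt_rowLen]
      exact lt_of_le_of_lt (Nat.zero_le _) hi
    simpa using ⟨0, this⟩
  rw [hrem, hadd, Set.ncard_insert_of_notMem (by simp) (hfin.image _),
    Set.ncard_image_of_injective _ Nat.succ_injective]

/-- Two distinct diagrams below `μ` join to `μ` and have a common diagram below them. -/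
theorem addsBox_inf_of_addsBox {ν κ μ : YoungDiagram} (hν : AddsBox ν μ) (hκ : AddsBox κ μ)
    (h : κ ≠ ν) : ν ⊔ κ = μ ∧ AddsBox (ν ⊓ κ) ν ∧ AddsBox (ν ⊓ κ) κ := by
  have h1 := hν.2
  have h2 := hκ.2
  have h3 := card_sup_add_card_inf ν κ
  have hle : ν ⊔ κ ≤ μ := sup_le hν.1 hκ.1
  have hlt : ν < ν ⊔ κ := lt_of_le_of_ne le_sup_left fun h' =>
    h (eq_of_le_of_card_le (h'.symm ▸ le_sup_right) (by omega))
  have h4 := card_lt_card_of_lt hlt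
  have h5 : (ν ⊔ κ).card ≤ μ.card := Finset.card_le_card hle
  exact ⟨eq_of_le_of_card_le hle (by omega), ⟨inf_le_left, by omega⟩, ⟨inf_le_right, by omega⟩⟩

/-- Two distinct diagrams above `ρ` meet in `ρ` and have a common diagram above them. -/
theorem addsBox_sup_of_addsBox {ν κ ρ : YoungDiagram} (hν : AddsBox ρ ν) (hκ : AddsBox ρ κ)
    (h : κ ≠ ν) : ν ⊓ κ = ρ ∧ AddsBox ν (ν ⊔ κ) ∧ AddsBox κ (ν ⊔ κ) := by
  have h1 := hν.2
  have h2 := hκ.2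
  have h3 := card_sup_add_card_inf ν κ
  have hle : ρ ≤ ν ⊓ κ := le_inf hν.1 hκ.1
  have hlt : ν < ν ⊔ κ := lt_of_le_of_ne le_sup_left fun h' =>
    h (eq_of_le_of_card_le (h'.symm ▸ le_sup_right) (by omega))
  have h4 := card_lt_card_of_lt hlt
  have h5 : ρ.card ≤ (ν ⊓ κ).card := Finset.card_le_card hle
  exact ⟨(eq_of_le_of_card_le hle (by omega)).symm, ⟨le_sup_left, by omega⟩,
    ⟨le_sup_right, by omega⟩⟩

open Classical in
/-- Going up and down the Young graph agrees with going down and up, apart from the paths that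
return to the diagram they started from. -/
theorem sum_boxAdditions_erase (ν : YoungDiagram) (f : YoungDiagram → ℤ) :
    ∑ μ ∈ boxAdditions ν, ∑ κ ∈ (boxRemovals μ).erase ν, f κ =
      ∑ ρ ∈ boxRemovals ν, ∑ κ ∈ (boxAdditions ρ).erase ν, f κ := by
  rw [Finset.sum_sigma', Finset.sum_sigma']
  refine Finset.sum_bij' (fun x _ => ⟨ν ⊓ x.2, x.2⟩) (fun x _ => ⟨ν ⊔ x.2, x.2⟩) ?_ ?_ ?_ ?_ ?_
  · rintro ⟨μ, κ⟩ h
    simp only [Finset.mem_sigma, mem_boxAdditions, Finset.mem_erase, mem_boxRemovals] at h ⊢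
    have := addsBox_inf_of_addsBox h.1 h.2.2 h.2.1
    exact ⟨this.2.1, h.2.1, this.2.2⟩
  · rintro ⟨ρ, κ⟩ h
    simp only [Finset.mem_sigma, mem_boxAdditions, Finset.mem_erase, mem_boxRemovals] at h ⊢
    have := addsBox_sup_of_addsBox h.1 h.2.2 h.2.1
    exact ⟨this.2.1, h.2.1, this.2.2⟩
  · rintro ⟨μ, κ⟩ h
    simp only [Finset.mem_sigma, mem_boxAdditions, Finset.mem_erase, mem_boxRemovals] at h
    simp [(addsBox_inf_of_addsBox h.1 h.2.2 h.2.1).1]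
  · rintro ⟨ρ, κ⟩ h
    simp only [Finset.mem_sigma, mem_boxAdditions, Finset.mem_erase, mem_boxRemovals] at h
    simp [(addsBox_sup_of_addsBox h.1 h.2.2 h.2.1).1]
  · intros; rfl

/-- The dual branching rule of the Young graph, which says that the representation of
`𝔖_{m+1}` induced from the one of `𝔖_m` with label `ν` has dimension `(m + 1) dim ν`. -/
theorem sum_boxAdditions_youngDim (ν : YoungDiagram) :
    ∑ μ ∈ boxAdditions ν, youngDim μ = (ν.card + 1) * youngDim ν := by
  classical
  induction h : ν.card using Nat.strong_induction_on generalizing ν with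
  | _ m ih =>
  have hup : ∀ μ ∈ boxAdditions ν, (youngDim μ : ℤ) =
      ∑ κ ∈ (boxRemovals μ).erase ν, (youngDim κ : ℤ) + youngDim ν := by
    intro μ hμ
    have hadd := mem_boxAdditions.1 hμ
    rw [Finset.sum_erase_add _ _ (mem_boxRemovals.2 hadd),
      youngDim_eq_sum_boxRemovals (by have := hadd.2; omega)]
    push_cast
    rfl
  have hdown : ∀ ρ ∈ boxRemovals ν, ∑ κ ∈ (boxAdditions ρ).erase ν, (youngDim κ : ℤ) =
      m * youngDim ρ - youngDim ν := by
    intro ρ hρ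
    have hadd := mem_boxRemovals.1 hρ
    have h2 := hadd.2
    have := ih ρ.card (by omega) ρ rfl
    rw [eq_sub_iff_add_eq, Finset.sum_erase_add _ _ (mem_boxAdditions.2 hadd), ← h, h2]
    exact_mod_cast this
  have hm : ∑ ρ ∈ boxRemovals ν, (m : ℤ) * youngDim ρ = m * youngDim ν := by
    rcases Nat.eq_zero_or_pos m with rfl | hpos
    · simp
    · rw [youngDim_eq_sum_boxRemovals (μ := ν) (by omega), ← Finset.mul_sum]
      push_cast
      rfl
  have key : (∑ μ ∈ boxAdditions ν, (youngDim μ : ℤ)) = (m + 1) * youngDim ν := by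
    rw [Finset.sum_congr rfl hup, Finset.sum_add_distrib,
      sum_boxAdditions_erase ν (fun κ => (youngDim κ : ℤ)), Finset.sum_congr rfl hdown,
      Finset.sum_sub_distrib, hm, Finset.sum_const, Finset.sum_const, card_boxAdditions]
    simp only [nsmul_eq_mul]
    push_cast
    ring
  exact_mod_cast key

/-! ### The sum of the squares of the dimensions of irreducible representations -/

section IrrDim
universe v
variable {T : Type v} [Group T]

theorem Irr.dim_pos (ζ : Irr T) : 0 < ζ.dim := by
  by_contra h
  have h0 : Module.finrank ℂ ζ.rep = 0 := by unfold Irr.dim at h; omega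
  have hsub : Subsingleton ζ.rep := Module.finrank_zero_iff.1 h0
  refine CategoryTheory.id_nonzero ζ.rep ?_
  apply Action.Hom.ext
  ext x
  exact Subsingleton.elim (α := ζ.rep) _ _

/-- The character of a simple representation is that of the chosen representative of its class. -/
theorem exists_irr_character (V : FDRep ℂ T) (hV : CategoryTheory.Simple V) :
    ∃ ζ : Irr T, V.character = ζ.rep.character := by
  let ζ : Irr T := Quotient.mk (irrepSetoid T) ⟨V, hV⟩
  have h : (irrepSetoid T).r (Quotient.out ζ) ⟨V, hV⟩ := Quotient.mk_out (s := irrepSetoid T) _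
  obtain ⟨e⟩ := h
  exact ⟨ζ, (FDRep.char_iso e).symm⟩

/-- The image of a morphism of representations is a subrepresentation of the target. -/
def rangeSubrepresentation {V W : FDRep ℂ T} (f : W ⟶ V) : Subrepresentation V.ρ where
  toSubmodule := LinearMap.range f.hom.hom.hom
  apply_mem_toSubmodule := by
    rintro g _ ⟨w, rfl⟩
    refine ⟨W.ρ g w, ?_⟩
    have := congrArg (fun φ => φ.hom.hom w) (f.comm g)
    exact this

/-- A nonzero representation without nontrivial subrepresentations is simple. -/
theorem simple_of_forall_subrepresentation (V : FDRep ℂ T) (h0 : Module.finrank ℂ V ≠ 0)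
    (h : ∀ σ : Subrepresentation V.ρ, σ = ⊥ ∨ σ = ⊤) : CategoryTheory.Simple V := by
  refine ⟨fun {W} f _ => ⟨?_, ?_⟩⟩
  · rintro hf rfl
    apply h0
    have hz : (CategoryTheory.CategoryStruct.id V : V ⟶ V) = 0 := by
      rw [← CategoryTheory.IsIso.inv_hom_id (0 : W ⟶ V), CategoryTheory.Limits.comp_zero]
    have hsub : Subsingleton V := ⟨fun x y => by
      have hx : ∀ x : V, x = 0 := fun x => congrArg (fun φ => φ.hom.hom.hom x) hz
      rw [hx x, hx y]⟩
    exact Module.finrank_zero_of_subsingleton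
  · intro hf
    have htop : LinearMap.range f.hom.hom.hom = ⊤ := by
      rcases h (rangeSubrepresentation f) with hσ | hσ
      · exfalso
        apply hf
        have hbot : LinearMap.range f.hom.hom.hom = ⊥ :=
          congrArg Subrepresentation.toSubmodule hσ
        rw [LinearMap.range_eq_bot] at hbot
        apply Action.Hom.ext
        ext x
        exact congrArg (fun φ => φ x) hbot
      · exact congrArg Subrepresentation.toSubmodule hσ
    have hepi : CategoryTheory.Epi f := by
      refine ⟨fun {U} a b hab => ?_⟩
      apply Action.Hom.ext
      ext x
      obtain ⟨w, rfl⟩ := LinearMap.range_eq_top.1 htop x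
      exact congrArg (fun φ => φ.hom.hom.hom w) hab
    exact CategoryTheory.isIso_of_mono_of_epi f

theorem character_eq_add_of_isCompl (V : FDRep ℂ T) {σ τ : Subrepresentation V.ρ}
    (h : IsCompl σ τ) :
    V.character =
      (FDRep.of σ.toRepresentation).character + (FDRep.of τ.toRepresentation).character := by
  have hc : IsCompl σ.toSubmodule τ.toSubmodule := by
    refine IsCompl.of_eq ?_ ?_
    · exact congrArg Subrepresentation.toSubmodule h.inf_eq_bot
    · exact congrArg Subrepresentation.toSubmodule h.sup_eq_top
  funext g
  have hconj : V.ρ g = (Submodule.prodEquivOfIsCompl _ _ hc).conj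
      ((σ.toRepresentation g).prodMap (τ.toRepresentation g)) := by
    refine LinearMap.ext fun x => ?_
    obtain ⟨⟨a, b⟩, rfl⟩ := (Submodule.prodEquivOfIsCompl _ _ hc).surjective x
    rw [LinearEquiv.conj_apply_apply, LinearEquiv.symm_apply_apply]
    simp only [Submodule.coe_prodEquivOfIsCompl', LinearMap.prodMap_apply, map_add]
    rfl
  simp only [FDRep.character, Pi.add_apply, FDRep.of_ρ']
  rw [hconj, LinearMap.trace_conj', LinearMap.trace_prodMap']

/-- By Maschke's theorem, every character is a combination of irreducible characters. -/
theorem exists_character_eq_sum [Finite T] (V : FDRep ℂ T) :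
    ∃ c : Irr T → ℂ, V.character = ∑ ζ, c ζ • ζ.rep.character := by
  classical
  induction h : Module.finrank ℂ V using Nat.strong_induction_on generalizing V with
  | _ d ih =>
  by_cases hd : d = 0
  · refine ⟨0, ?_⟩
    have hsub : Subsingleton V := Module.finrank_zero_iff.1 (h.trans hd)
    funext g
    have : V.ρ g = 0 := LinearMap.ext fun x => Subsingleton.elim _ _
    simp [FDRep.character, this]
  by_cases hV : ∀ σ : Subrepresentation V.ρ, σ = ⊥ ∨ σ = ⊤
  · obtain ⟨ζ, hζ⟩ := exists_irr_character V
      (simple_of_forall_subrepresentation V (h ▸ hd) hV)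
    exact ⟨Pi.single ζ 1, by simp [hζ, Pi.single_apply]⟩
  · push Not at hV
    obtain ⟨σ, hbot, htop⟩ := hV
    have hne : NeZero (Nat.card T : ℂ) := ⟨by exact_mod_cast Nat.card_pos.ne'⟩
    have hss : Representation.IsSemisimpleRepresentation (G := T) (k := ℂ) V.ρ := inferInstance
    obtain ⟨τ, hστ⟩ := exists_isCompl σ
    have hlt : ∀ ρ : Subrepresentation V.ρ, ρ ≠ ⊤ → Module.finrank ℂ ρ.toSubmodule < d := by
      intro ρ hρ
      rw [← h]
      refine Submodule.finrank_lt (fun h' => hρ ?_)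
      exact Subrepresentation.toSubmodule_injective h'
    have hτ : τ ≠ ⊤ := by
      rintro rfl
      exact hbot (by simpa using hστ.inf_eq_bot)
    obtain ⟨c, hc⟩ := ih _ (hlt σ htop) (FDRep.of σ.toRepresentation) rfl
    obtain ⟨e, he⟩ := ih _ (hlt τ hτ) (FDRep.of τ.toRepresentation) rfl
    refine ⟨c + e, ?_⟩
    rw [character_eq_add_of_isCompl V hστ, hc, he, ← Finset.sum_add_distrib]
    simp [add_smul]

/-- The regular representation, on `ℂ^|T|` rather than on `T → ℂ` because the carriers of the
objects of `FDRep ℂ T` lie in the universe of `ℂ`. -/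
noncomputable def regularRep (T : Type v) [Group T] [Finite T] : FDRep ℂ T :=
  FDRep.of (V := Fin (Nat.card T) → ℂ)
    { toFun := fun g => LinearMap.funLeft ℂ ℂ fun i =>
        Finite.equivFin T (g⁻¹ * (Finite.equivFin T).symm i)
      map_one' := by ext; simp [LinearMap.funLeft]
      map_mul' := fun g h => by
        ext
        simp [LinearMap.funLeft, mul_assoc] }

open Classical in
theorem character_regularRep [Finite T] (g : T) :
    (regularRep T).character g = if g = 1 then (Nat.card T : ℂ) else 0 := by
  change LinearMap.trace ℂ (Fin (Nat.card T) → ℂ) (LinearMap.funLeft ℂ ℂ fun i =>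
    Finite.equivFin T (g⁻¹ * (Finite.equivFin T).symm i)) = _
  rw [LinearMap.trace_eq_matrix_trace ℂ (Pi.basisFun ℂ (Fin (Nat.card T))), Matrix.trace]
  have hdiag : ∀ i : Fin (Nat.card T), Finite.equivFin T (g⁻¹ * (Finite.equivFin T).symm i) = i ↔
      g = 1 := by
    intro i
    rw [← Equiv.eq_symm_apply, mul_eq_right, inv_eq_one]
  simp only [Matrix.diag_apply, LinearMap.toMatrix_apply, Pi.basisFun_apply, Pi.basisFun_repr,
    LinearMap.funLeft_apply, Pi.single_apply, hdiag]
  split_ifs <;> simp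

/-- The regular character contains each irreducible character as often as its dimension, so that
its value at `1` is the sum of the squares of the dimensions. -/
theorem sum_dim_sq [Finite T] : ∑ ζ : Irr T, (ζ.dim : ℝ) ^ 2 = Nat.card T := by
  classical
  have : Fintype T := Fintype.ofFinite T
  have hne : (Nat.card T : ℂ) ≠ 0 := by exact_mod_cast Nat.card_pos.ne'
  have : Invertible (Nat.card T : ℂ) := invertibleOfNonzero hne
  obtain ⟨c, hc⟩ := exists_character_eq_sum (regularRep T)
  have hcoef : ∀ η : Irr T, c η = η.dim := by
    intro η
    have h1 : (Nat.card T : ℂ)⁻¹ * ∑ g : T, (regularRep T).character g * η.rep.character g⁻¹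
        = η.dim := by
      simp only [character_regularRep, ite_mul, zero_mul, Finset.sum_ite_eq', Finset.mem_univ,
        if_true, inv_one, FDRep.char_one]
      rw [inv_mul_cancel_left₀ hne]
      rfl
    rw [← h1, hc]
    calc c η = ∑ ζ, c ζ * (if Nonempty (ζ.rep ≅ η.rep) then 1 else 0) := by
          rw [Finset.sum_eq_single η]
          · simp [show Nonempty (η.rep ≅ η.rep) from ⟨CategoryTheory.Iso.refl _⟩]
          · intro ζ _ hζ
            simp [show ¬ Nonempty (ζ.rep ≅ η.rep) from fun h => hζ (Irr.eq_of_iso h)]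
          · simp
      _ = _ := by
          simp only [Finset.sum_apply, Pi.smul_apply, smul_eq_mul, Finset.mul_sum, Finset.sum_mul]
          rw [Finset.sum_comm]
          refine Finset.sum_congr rfl fun ζ _ => ?_
          rw [← FDRep.char_orthonormal, Finset.mul_sum, Finset.mul_sum]
          refine Finset.sum_congr rfl fun g _ => ?_
          ring
  have h1 := congrFun hc 1
  rw [character_regularRep, if_pos rfl] at h1
  simp only [Finset.sum_apply, Pi.smul_apply, FDRep.char_one, hcoef, smul_eq_mul] at h1
  have h2 : (∑ ζ : Irr T, (ζ.dim : ℂ) ^ 2) = Nat.card T := by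
    rw [h1]
    exact Finset.sum_congr rfl fun ζ _ => sq _
  exact_mod_cast h2

end IrrDim

/-! ### The Res-Ind transition matrix -/

section Transition

variable {T : Type*} [Group T] [Finite T] {m n : ℕ}

theorem MultiDiagram.dim_eq_factorial_mul_prod (l : MultiDiagram T n) :
    l.dim = n.factorial * ∏ ζ, ((ζ.dim : ℝ) ^ (l.1 ζ).card * (youngDim (l.1 ζ) : ℝ) /
      ((l.1 ζ).card.factorial : ℝ)) := by
  rw [Finset.prod_div_distrib, MultiDiagram.dim, div_mul_eq_mul_div, mul_div_assoc]
  rfl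

theorem MultiDiagram.dim_pos (l : MultiDiagram T n) : 0 < l.dim := by
  rw [l.dim_eq_factorial_mul_prod]
  refine mul_pos (by positivity) (Finset.prod_pos fun ζ _ => ?_)
  have h1 := ζ.dim_pos
  have h2 := youngDim_pos (l.1 ζ)
  positivity

theorem AddsBoxAt.addsBox {v : MultiDiagram T m} {l : MultiDiagram T n} {η : Irr T}
    (h : AddsBoxAt v l η) : AddsBox (v.1 η) (l.1 η) :=
  ⟨h.1, h.2.1⟩

open Classical in
theorem AddsBoxAt.size_eq {v : MultiDiagram T m} {l : MultiDiagram T n} {η : Irr T}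
    (h : AddsBoxAt v l η) (ζ : Irr T) :
    (l.size ζ : ℝ) = v.size ζ + if η = ζ then 1 else 0 := by
  by_cases hζ : η = ζ
  · subst hζ
    simp [MultiDiagram.size, h.2.1]
  · simp [MultiDiagram.size, h.2.2 ζ (Ne.symm hζ), hζ]

/-- Along an edge with label `η` only the factors of the dimension at `η` change. -/
theorem AddsBoxAt.dim_mul_eq (hmn : n = m + 1) {v : MultiDiagram T m} {l : MultiDiagram T n}
    {η : Irr T} (h : AddsBoxAt v l η) :
    l.dim * (l.size η * youngDim (v.1 η)) = v.dim * (n * η.dim * youngDim (l.1 η)) := by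
  classical
  rw [l.dim_eq_factorial_mul_prod, v.dim_eq_factorial_mul_prod,
    ← Finset.mul_prod_erase _ _ (Finset.mem_univ η),
    ← Finset.mul_prod_erase (Finset.univ : Finset (Irr T)) _ (Finset.mem_univ η)]
  have hrest : ∀ ζ ∈ (Finset.univ : Finset (Irr T)).erase η,
      (ζ.dim : ℝ) ^ (l.1 ζ).card * (youngDim (l.1 ζ) : ℝ) / ((l.1 ζ).card.factorial : ℝ) =
      (ζ.dim : ℝ) ^ (v.1 ζ).card * (youngDim (v.1 ζ) : ℝ) / ((v.1 ζ).card.factorial : ℝ) :=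
    fun ζ hζ => by rw [h.2.2 ζ (Finset.ne_of_mem_erase hζ)]
  rw [Finset.prod_congr rfl hrest]
  subst hmn
  simp only [MultiDiagram.size, h.2.1, Nat.factorial_succ]
  push_cast
  have : ((v.1 η).card + 1 : ℝ) ≠ 0 := by positivity
  field_simp
  ring

open Classical in
/-- The diagrams below `l` along edges with label `η` correspond to the removable boxes of the
entry of `l` at `η`. -/
theorem sum_addsBoxAt_left (hmn : n = m + 1) (l : MultiDiagram T n) (η : Irr T)
    (F : YoungDiagram → ℝ) :
    ∑ v : MultiDiagram T m, (if AddsBoxAt v l η then F (v.1 η) else 0) =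
      ∑ ν ∈ boxRemovals (l.1 η), F ν := by
  rw [← Finset.sum_filter]
  have hl := l.2
  rw [← Finset.add_sum_erase _ _ (Finset.mem_univ η)] at hl
  refine Finset.sum_bij (fun v _ => v.1 η) (fun v hv => ?_) (fun v hv w hw h => ?_)
    (fun ν hν => ?_) fun _ _ => rfl
  · exact mem_boxRemovals.2 (Finset.mem_filter.1 hv).2.addsBox
  · have hv := (Finset.mem_filter.1 hv).2
    have hw := (Finset.mem_filter.1 hw).2
    refine Subtype.ext (funext fun ζ => ?_)
    by_cases hζ : ζ = η
    · exact hζ ▸ h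
    · rw [← hv.2.2 ζ hζ, ← hw.2.2 ζ hζ]
  · have hν := mem_boxRemovals.1 hν
    refine ⟨⟨Function.update l.1 η ν, ?_⟩, ?_, by simp⟩
    · rw [← Finset.add_sum_erase _ _ (Finset.mem_univ η), Function.update_self,
        Finset.sum_congr rfl (g := fun ζ => (l.1 ζ).card) fun ζ hζ => by
          rw [Function.update_of_ne (Finset.ne_of_mem_erase hζ)]]
      have := hν.2
      omega
    · refine Finset.mem_filter.2 ⟨Finset.mem_univ _, ?_, ?_, fun ζ hζ =>
        (Function.update_of_ne hζ _ _).symm⟩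
      · change Function.update l.1 η ν η ≤ l.1 η
        rw [Function.update_self]
        exact hν.1
      · change (l.1 η).card = (Function.update l.1 η ν η).card + 1
        rw [Function.update_self]
        exact hν.2

open Classical in
/-- The diagrams above `v` along edges with label `η` correspond to the addable boxes of the
entry of `v` at `η`. -/
theorem sum_addsBoxAt_right (hmn : n = m + 1) (v : MultiDiagram T m) (η : Irr T)
    (F : YoungDiagram → ℝ) :
    ∑ l : MultiDiagram T n, (if AddsBoxAt v l η then F (l.1 η) else 0) =
      ∑ μ ∈ boxAdditions (v.1 η), F μ := by
  rw [← Finset.sum_filter]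
  have hv := v.2
  rw [← Finset.add_sum_erase _ _ (Finset.mem_univ η)] at hv
  refine Finset.sum_bij (fun l _ => l.1 η) (fun l hl => ?_) (fun k hk l hl h => ?_)
    (fun μ hμ => ?_) fun _ _ => rfl
  · exact mem_boxAdditions.2 (Finset.mem_filter.1 hl).2.addsBox
  · have hk := (Finset.mem_filter.1 hk).2
    have hl := (Finset.mem_filter.1 hl).2
    refine Subtype.ext (funext fun ζ => ?_)
    by_cases hζ : ζ = η
    · exact hζ ▸ h
    · rw [hk.2.2 ζ hζ, hl.2.2 ζ hζ]
  · have hμ := mem_boxAdditions.1 hμ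
    refine ⟨⟨Function.update v.1 η μ, ?_⟩, ?_, by simp⟩
    · rw [← Finset.add_sum_erase _ _ (Finset.mem_univ η), Function.update_self,
        Finset.sum_congr rfl (g := fun ζ => (v.1 ζ).card) fun ζ hζ => by
          rw [Function.update_of_ne (Finset.ne_of_mem_erase hζ)]]
      have := hμ.2
      omega
    · refine Finset.mem_filter.2 ⟨Finset.mem_univ _, ?_, ?_, fun ζ hζ =>
        Function.update_of_ne hζ _ _⟩
      · change v.1 η ≤ Function.update v.1 η μ η
        rw [Function.update_self]
        exact hμ.1
      · change (Function.update v.1 η μ η).card = (v.1 η).card + 1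
        rw [Function.update_self]
        exact hμ.2

open Classical in
/-- In a restriction step from `l`, the box is removed from the entry with label `η` with
probability `|l^η| / n`. -/
theorem sum_addsBoxAt_dim_left (hmn : n = m + 1) (l : MultiDiagram T n) (η : Irr T) :
    ∑ v : MultiDiagram T m, (if AddsBoxAt v l η then η.dim * v.dim / l.dim else 0) =
      l.size η / n := by
  have hn : (n : ℝ) ≠ 0 := by rw [hmn]; positivity
  have hf : (youngDim (l.1 η) : ℝ) ≠ 0 := by exact_mod_cast (youngDim_pos _).ne'
  have hstep : ∀ v : MultiDiagram T m,
      (if AddsBoxAt v l η then η.dim * v.dim / l.dim else 0) =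
      if AddsBoxAt v l η then
        (l.size η / (n * youngDim (l.1 η)) : ℝ) * youngDim (v.1 η) else 0 := by
    intro v
    split_ifs with h
    · have hl := l.dim_pos.ne'
      have := h.dim_mul_eq hmn
      field_simp
      linear_combination -this
    · rfl
  rw [Finset.sum_congr rfl fun v _ => hstep v, sum_addsBoxAt_left hmn l η
    (fun ν => (l.size η / (n * youngDim (l.1 η)) : ℝ) * youngDim ν), ← Finset.mul_sum]
  by_cases h0 : l.size η = 0
  · simp [h0]
  · rw [← Nat.cast_sum, ← youngDim_eq_sum_boxRemovals h0]
    field_simp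

open Classical in
/-- In an induction step, the box is added to the entry with label `η` with probability
`(dim η)² / |T|`. -/
theorem sum_addsBoxAt_dim_right (hmn : n = m + 1) (v : MultiDiagram T m) (η : Irr T) :
    ∑ l : MultiDiagram T n,
      (if AddsBoxAt v l η then η.dim * l.dim / (n * Nat.card T * v.dim) else 0) =
      (η.dim : ℝ) ^ 2 / Nat.card T := by
  have hn : (n : ℝ) ≠ 0 := by rw [hmn]; positivity
  have hT : (Nat.card T : ℝ) ≠ 0 := by exact_mod_cast Nat.card_pos.ne'
  have hf : (youngDim (v.1 η) : ℝ) ≠ 0 := by exact_mod_cast (youngDim_pos _).ne'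
  have hv := v.dim_pos.ne'
  have hk : ((v.1 η).card + 1 : ℝ) ≠ 0 := by positivity
  have hstep : ∀ l : MultiDiagram T n,
      (if AddsBoxAt v l η then η.dim * l.dim / (n * Nat.card T * v.dim) else 0) =
      if AddsBoxAt v l η then
        ((η.dim : ℝ) ^ 2 / (Nat.card T * (((v.1 η).card + 1) * youngDim (v.1 η)))) *
          youngDim (l.1 η) else 0 := by
    intro l
    split_ifs with h
    · have := h.dim_mul_eq hmn
      have hsize : (l.size η : ℝ) = (v.1 η).card + 1 := by
        rw [MultiDiagram.size, h.2.1]; push_cast; rfl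
      rw [hsize] at this
      field_simp
      linear_combination (η.dim : ℝ) * this
    · rfl
  rw [Finset.sum_congr rfl fun v _ => hstep v, sum_addsBoxAt_right hmn v η
    (fun μ => ((η.dim : ℝ) ^ 2 / (Nat.card T * (((v.1 η).card + 1) * youngDim (v.1 η)))) *
      youngDim μ), ← Finset.mul_sum, ← Nat.cast_sum, sum_boxAdditions_youngDim]
  push_cast
  field_simp

/-- The expected size of an entry after a restriction step, shifted by `c`. -/
theorem sum_restriction_mul_size (hmn : n = m + 1) (l : MultiDiagram T n) (ζ : Irr T) (c : ℝ) :
    ∑ v : MultiDiagram T m, branchMult v l * v.dim / l.dim * (v.size ζ + c) =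
      (1 - 1 / n) * l.size ζ + c := by
  classical
  have hn : (n : ℝ) ≠ 0 := by rw [hmn]; positivity
  calc _ = ∑ v : MultiDiagram T m, ∑ η, (if AddsBoxAt v l η then η.dim * v.dim / l.dim else 0) *
        ((l.size ζ : ℝ) - (if η = ζ then 1 else 0) + c) := by
        refine Finset.sum_congr rfl fun v _ => ?_
        rw [branchMult, Finset.sum_mul, Finset.sum_div, Finset.sum_mul]
        refine Finset.sum_congr rfl fun η _ => ?_
        by_cases h : AddsBoxAt v l η
        · simp only [h, if_true, h.size_eq ζ, add_sub_cancel_right]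
        · simp [h]
    _ = ∑ η, (l.size η / n : ℝ) * ((l.size ζ : ℝ) - (if η = ζ then 1 else 0) + c) := by
        rw [Finset.sum_comm]
        refine Finset.sum_congr rfl fun η _ => ?_
        rw [← Finset.sum_mul, sum_addsBoxAt_dim_left hmn]
    _ = (∑ η, (l.size η : ℝ)) / n * (l.size ζ + c) - l.size ζ / n := by
        rw [Finset.sum_div, Finset.sum_mul]
        have : ∀ η, (l.size η / n : ℝ) * ((l.size ζ : ℝ) - (if η = ζ then 1 else 0) + c) =
            l.size η / n * (l.size ζ + c) - (if η = ζ then (l.size η / n : ℝ) else 0) := by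
          intro η
          split_ifs <;> ring
        simp_rw [this]
        rw [Finset.sum_sub_distrib]
        simp
    _ = _ := by
        have : (∑ η, (l.size η : ℝ)) = n := by exact_mod_cast l.2
        rw [this]
        field_simp
        ring

/-- The expected size of an entry after an induction step. -/
theorem sum_induction_mul_size (hmn : n = m + 1) (v : MultiDiagram T m) (ζ : Irr T) :
    ∑ l : MultiDiagram T n, branchMult v l * l.dim / (n * Nat.card T * v.dim) * l.size ζ =
      v.size ζ + (ζ.dim : ℝ) ^ 2 / Nat.card T := by
  classical
  have hT : (Nat.card T : ℝ) ≠ 0 := by exact_mod_cast Nat.card_pos.ne'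
  calc _ = ∑ l : MultiDiagram T n, ∑ η,
        (if AddsBoxAt v l η then η.dim * l.dim / (n * Nat.card T * v.dim) else 0) *
        ((v.size ζ : ℝ) + if η = ζ then 1 else 0) := by
        refine Finset.sum_congr rfl fun l _ => ?_
        rw [branchMult, Finset.sum_mul, Finset.sum_div, Finset.sum_mul]
        refine Finset.sum_congr rfl fun η _ => ?_
        by_cases h : AddsBoxAt v l η
        · simp only [h, if_true, h.size_eq ζ]
        · simp [h]
    _ = ∑ η : Irr T, ((η.dim : ℝ) ^ 2 / Nat.card T) *
        ((v.size ζ : ℝ) + if η = ζ then 1 else 0) := by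
        rw [Finset.sum_comm]
        refine Finset.sum_congr rfl fun η _ => ?_
        rw [← Finset.sum_mul, sum_addsBoxAt_dim_right hmn]
    _ = (∑ η : Irr T, (η.dim : ℝ) ^ 2) / Nat.card T * v.size ζ +
        (ζ.dim : ℝ) ^ 2 / Nat.card T := by
        rw [Finset.sum_div, Finset.sum_mul]
        simp_rw [mul_add]
        rw [Finset.sum_add_distrib]
        simp
    _ = _ := by
        rw [sum_dim_sq, div_self hT, one_mul]

/-- The relative size of the entry with label `ζ` is, up to a constant, an eigenfunction of the
Res-Ind chain with eigenvalue `1 - 1 / n`. -/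
theorem sum_P_mul_size_div (hn : 1 ≤ n) (l : MultiDiagram T n) (ζ : Irr T) :
    ∑ k, P T n l k * ((k.size ζ : ℝ) / n) =
      (1 - 1 / n) * ((l.size ζ : ℝ) / n) +
        (1 - (1 - 1 / n)) * ((ζ.dim : ℝ) ^ 2 / Nat.card T) := by
  have hmn : n = n - 1 + 1 := by omega
  have key : ∑ k, P T n l k * (k.size ζ : ℝ) =
      (1 - 1 / n) * (l.size ζ : ℝ) + (ζ.dim : ℝ) ^ 2 / Nat.card T := by
    simp only [P, Matrix.mul_apply, Finset.sum_mul]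
    rw [Finset.sum_comm, ← sum_restriction_mul_size hmn l ζ]
    refine Finset.sum_congr rfl fun v _ => ?_
    rw [← sum_induction_mul_size hmn v ζ, Finset.mul_sum]
    refine Finset.sum_congr rfl fun k _ => ?_
    simp only [PDown, PUp]
    ring
  simp_rw [mul_div_assoc']
  rw [← Finset.sum_div, key]
  ring

end Transition

/-! ### Expectations along a finite Markov chain -/

section MarkovChain

variable {S Ω : Type*} [Fintype S] [MeasurableSpace S] [MeasurableSingletonClass S]
  [MeasurableSpace Ω] {Pr : Measure Ω} [IsProbabilityMeasure Pr] {Q : Matrix S S ℝ}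
  {Z : ℕ → Ω → S}

theorem integrable_of_finite_range {g : Ω → S} (hg : Measurable g) (f : S → ℝ) :
    Integrable (fun ω => f (g ω)) Pr := by
  have : Integrable f (Pr.map g) := by
    have := Measure.isProbabilityMeasure_map (μ := Pr) hg.aemeasurable
    exact .of_finite
  exact this.comp_measurable hg

theorem IsMarkovChain.integral_eq_sum_paths (hZ : IsMarkovChain Pr Q Z) (f : S → ℝ) (k : ℕ) :
    ∫ ω, f (Z k ω) ∂Pr =
      ∑ w : Fin (k + 1) → S, Pr.real {ω | ∀ i : Fin (k + 1), Z i ω = w i} * f (w (Fin.last k)) := by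
  have hW : Measurable fun ω => fun i : Fin (k + 1) => Z i ω :=
    measurable_pi_lambda _ fun i => hZ.measurable i
  have := Measure.isProbabilityMeasure_map (μ := Pr) hW.aemeasurable
  have hmap := integral_map (μ := Pr) hW.aemeasurable
    (f := fun w : Fin (k + 1) → S => f (w (Fin.last k)))
    (Measurable.of_discrete).aestronglyMeasurable
  simp only [Fin.val_last] at hmap
  rw [← hmap, integral_fintype .of_finite]
  refine Finset.sum_congr rfl fun w _ => ?_
  rw [map_measureReal_apply hW (measurableSet_singleton w), smul_eq_mul]
  congr 2
  ext ω
  simp [funext_iff]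

/-- The Markov property for a single step, in terms of finite paths. -/
theorem IsMarkovChain.path_snoc {S Ω : Type*} [MeasurableSpace S] [MeasurableSpace Ω]
    {Pr : Measure Ω} {Q : Matrix S S ℝ} {Z : ℕ → Ω → S} (hZ : IsMarkovChain Pr Q Z) (k : ℕ)
    (w : Fin (k + 1) → S) (y : S) :
    Pr.real {ω | ∀ i : Fin (k + 1 + 1), Z i ω = (Fin.snoc w y : Fin (k + 1 + 1) → S) i} =
      Pr.real {ω | ∀ i : Fin (k + 1), Z i ω = w i} * Q (w (Fin.last k)) y := by
  -- an infinite path with initial segment `w`, `y`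
  set z : ℕ → S := fun i => if h : i < k + 1 then w ⟨i, h⟩ else y with hz
  have hzw : ∀ i : Fin (k + 1), z i = w i := fun i => dif_pos i.2
  have hzy : z (k + 1) = y := dif_neg (lt_irrefl _)
  have hsnoc : ∀ i, (Fin.snoc w y : Fin (k + 1 + 1) → S) i = z i := by
    intro i
    refine Fin.lastCases ?_ (fun i => ?_) i
    · rw [Fin.snoc_last, Fin.val_last, hzy]
    · rw [Fin.snoc_castSucc, Fin.val_castSucc, hzw]
  have h1 : {ω | ∀ i : Fin (k + 1 + 1), Z i ω = (Fin.snoc w y : Fin (k + 1 + 1) → S) i} =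
      {ω | ∀ i ≤ k + 1, Z i ω = z i} := by
    ext ω
    refine ⟨fun h i hi => ?_, fun h i => (h i (by omega)).trans (hsnoc i).symm⟩
    exact (h ⟨i, by omega⟩).trans (hsnoc ⟨i, by omega⟩)
  have h2 : {ω | ∀ i : Fin (k + 1), Z i ω = w i} = {ω | ∀ i ≤ k, Z i ω = z i} := by
    ext ω
    refine ⟨fun h i hi => ?_, fun h i => (h i (by omega)).trans (hzw i)⟩
    exact (h ⟨i, by omega⟩).trans (hzw ⟨i, by omega⟩).symm
  have hlast : z k = w (Fin.last k) := hzw (Fin.last k)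
  rw [h1, h2, hZ.law, hZ.law, Finset.prod_range_succ, ← mul_assoc, hlast, hzy]

theorem IsMarkovChain.integral_succ (hZ : IsMarkovChain Pr Q Z) (f : S → ℝ) (k : ℕ) :
    ∫ ω, f (Z (k + 1) ω) ∂Pr = ∫ ω, (∑ y, Q (Z k ω) y * f y) ∂Pr := by
  rw [hZ.integral_eq_sum_paths f (k + 1),
    hZ.integral_eq_sum_paths (fun x => ∑ y, Q x y * f y) k,
    ← (Fin.snocEquiv fun _ : Fin (k + 1 + 1) => S).sum_comp, Fintype.sum_prod_type_right]
  refine Finset.sum_congr rfl fun w _ => ?_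
  rw [Finset.mul_sum]
  refine Finset.sum_congr rfl fun y _ => ?_
  have := hZ.path_snoc k w y
  simp only [Fin.snocEquiv, Equiv.coe_fn_mk, Fin.snoc_last] at this ⊢
  rw [this]
  ring

/-- If `f - b` is an eigenfunction of the transition matrix with eigenvalue `q`, then its
expectation decays geometrically along the chain. -/
theorem IsMarkovChain.integral_eq_of_eigen (hZ : IsMarkovChain Pr Q Z) {f : S → ℝ} {q b : ℝ}
    (hf : ∀ x, ∑ y, Q x y * f y = q * f x + (1 - q) * b) (k : ℕ) :
    ∫ ω, f (Z k ω) ∂Pr = b + q ^ k * (∫ ω, f (Z 0 ω) ∂Pr - b) := by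
  induction k with
  | zero => simp
  | succ k ih =>
    rw [hZ.integral_succ]
    simp only [hf]
    rw [integral_add ((integrable_of_finite_range (hZ.measurable k) f).const_mul q)
      (integrable_const _), integral_const_mul, ih]
    simp
    ring

end MarkovChain

/-! ### The counting process of the pausing times -/

section Renewal

theorem measurable_counting {Ω : Type*} [MeasurableSpace Ω] {ε : ℕ → Ω → ℝ}
    (hε : ∀ j, Measurable (ε j)) (s : ℝ) :
    Measurable (counting ε s) := by
  classical
  have hmeas : ∀ j, MeasurableSet {ω | s < ∑ i ∈ Finset.range (j + 1), ε i ω} := fun j =>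
    measurableSet_lt measurable_const (Finset.measurable_fun_sum _ fun i _ => hε i)
  -- the second alternative makes the search succeed where `counting` is `0` by convention
  have hex : ∀ ω, ∃ j, s < ∑ i ∈ Finset.range (j + 1), ε i ω ∨
      ∀ k, ¬ s < ∑ i ∈ Finset.range (k + 1), ε i ω := fun ω => by
    by_cases h : ∃ j, s < ∑ i ∈ Finset.range (j + 1), ε i ω
    · exact h.imp fun j hj => Or.inl hj
    · exact ⟨0, Or.inr (not_exists.1 h)⟩
  have hcount : counting ε s = fun ω => Nat.find (hex ω) := by
    funext ω
    by_cases h : ∃ j, s < ∑ i ∈ Finset.range (j + 1), ε i ω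
    · have hne : {j : ℕ | s < ∑ i ∈ Finset.range (j + 1), ε i ω}.Nonempty := h
      refine le_antisymm (Nat.sInf_le ?_) (Nat.find_min' _ (Or.inl (Nat.sInf_mem hne)))
      exact (Nat.find_spec (hex ω)).resolve_right fun h' => h.elim fun k hk => h' k hk
    · have h0 : {j : ℕ | s < ∑ i ∈ Finset.range (j + 1), ε i ω} = ∅ :=
        Set.eq_empty_of_forall_notMem (not_exists.1 h)
      rw [counting, h0, Nat.sInf_empty, eq_comm, Nat.find_eq_zero]
      exact Or.inr (not_exists.1 h)
  rw [hcount]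
  refine measurable_find hex fun k => ?_
  have : {ω | s < ∑ i ∈ Finset.range (k + 1), ε i ω ∨
      ∀ k, ¬ s < ∑ i ∈ Finset.range (k + 1), ε i ω} =
      {ω | s < ∑ i ∈ Finset.range (k + 1), ε i ω} ∪
        ⋂ k, {ω | s < ∑ i ∈ Finset.range (k + 1), ε i ω}ᶜ := by
    ext ω; simp
  rw [this]
  exact (hmeas k).union (MeasurableSet.iInter fun k => (hmeas k).compl)

/-- The defining inequalities of the counting process, for positive pausing times with unbounded
partial sums. -/
theorem counting_eq_iff {Ω : Type*} {ε : ℕ → Ω → ℝ} {s : ℝ} (hs : 0 ≤ s) {ω : Ω}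
    (hpos : ∀ j, 0 < ε j ω) (hex : ∃ j, s < ∑ i ∈ Finset.range j, ε i ω) (j : ℕ) :
    counting ε s ω = j ↔
      ∑ i ∈ Finset.range j, ε i ω ≤ s ∧ s < ∑ i ∈ Finset.range (j + 1), ε i ω := by
  have hmono : Monotone fun j => ∑ i ∈ Finset.range j, ε i ω := monotone_nat_of_le_succ fun j => by
    rw [Finset.sum_range_succ]
    linarith [hpos j]
  have hne : {j : ℕ | s < ∑ i ∈ Finset.range (j + 1), ε i ω}.Nonempty :=
    hex.imp fun j hj => hj.trans_le (hmono (Nat.le_succ j))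
  constructor
  · rintro rfl
    refine ⟨?_, Nat.sInf_mem hne⟩
    rcases hk : counting ε s ω with _ | k
    · simpa using hs
    · have : k ∉ {j : ℕ | s < ∑ i ∈ Finset.range (j + 1), ε i ω} :=
        Nat.notMem_of_lt_sInf (by rw [counting] at hk; omega)
      simpa using this
  · rintro ⟨h1, h2⟩
    refine le_antisymm (Nat.sInf_le h2) (le_csInf hne fun k hk => ?_)
    by_contra hlt
    have h3 : ∑ i ∈ Finset.range (k + 1), ε i ω ≤ ∑ i ∈ Finset.range j, ε i ω :=
      hmono (by omega)
    have hk' : s < ∑ i ∈ Finset.range (k + 1), ε i ω := hk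
    linarith

theorem counting_zero {Ω : Type*} {ε : ℕ → Ω → ℝ} {ω : Ω} (h : 0 < ε 0 ω) : counting ε 0 ω = 0 := by
  have : (0 : ℕ) ∈ {j : ℕ | (0 : ℝ) < ∑ i ∈ Finset.range (j + 1), ε i ω} := by simpa using h
  exact Nat.le_zero.1 (Nat.sInf_le this)

theorem ae_pos {Ω : Type*} [MeasurableSpace Ω] {Pr : Measure Ω} {ψ : Measure ℝ} {ε : ℕ → Ω → ℝ}
    (hψ : ψ (Set.Iic 0) = 0) (hε : ∀ j, Measurable (ε j))
    (hlaw : ∀ j, Pr.map (ε j) = ψ) : ∀ᵐ ω ∂Pr, ∀ j, 0 < ε j ω := by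
  rw [ae_all_iff]
  intro j
  have h : ψ {x | ¬ 0 < x} = 0 := by
    rw [← hψ]; congr 1; ext; simp
  rw [← hlaw j] at h
  exact ae_of_ae_map (hε j).aemeasurable h

/-- The Laplace transform of a law on `(0, ∞)` is smaller than `1` at `1`. -/
theorem mgf_neg_one_lt_one {ψ : Measure ℝ} [IsProbabilityMeasure ψ] (hψ : ψ (Set.Iic 0) = 0) :
    mgf id ψ (-1) < 1 := by
  have hpos : ∀ᵐ x ∂ψ, 0 < x := by
    rw [ae_iff, ← hψ]; congr 1; ext; simp
  have hint : Integrable (fun x : ℝ => Real.exp (-1 * x)) ψ := by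
    refine .of_bound (by fun_prop) 1 (hpos.mono fun x hx => ?_)
    rw [Real.norm_eq_abs, Real.abs_exp, Real.exp_le_one_iff]
    linarith
  have h0 : 0 < ∫ x, (1 - Real.exp (-1 * x)) ∂ψ := by
    have hnn : 0 ≤ᵐ[ψ] fun x => 1 - Real.exp (-1 * x) := hpos.mono fun x hx => by
      have : Real.exp (-1 * x) ≤ 1 := Real.exp_le_one_iff.2 (by linarith)
      simpa using this
    rw [integral_pos_iff_support_of_nonneg_ae hnn ((integrable_const _).sub hint)]
    refine (zero_lt_one.trans_eq measure_univ.symm).trans_le (measure_mono_ae ?_)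
    filter_upwards [hpos] with x hx _
    have : Real.exp (-1 * x) < 1 := Real.exp_lt_one_iff.2 (by linarith)
    exact (sub_pos.2 this).ne'
  rw [integral_sub (integrable_const _) hint] at h0
  simp only [integral_const, probReal_univ, smul_eq_mul, mul_one] at h0
  simpa [mgf] using h0

variable {Ω : Type*} [MeasurableSpace Ω] {Pr : Measure Ω} [IsProbabilityMeasure Pr]
  {ψ : Measure ℝ} {ε : ℕ → Ω → ℝ}

/-- The partial sums of the pausing times are almost surely unbounded, by a Chernoff bound. -/
theorem ae_exists_lt_sum [IsProbabilityMeasure ψ] (hψ : ψ (Set.Iic 0) = 0)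
    (hε : ∀ j, Measurable (ε j))
    (hlaw : ∀ j, Pr.map (ε j) = ψ) (hindep : iIndepFun ε Pr) (s : ℝ) :
    ∀ᵐ ω ∂Pr, ∃ j, s < ∑ i ∈ Finset.range j, ε i ω := by
  have hpos := ae_pos hψ hε hlaw
  set r := mgf id ψ (-1) with hr
  have hr0 : 0 ≤ r := mgf_nonneg
  have hbound : ∀ j, Pr.real {ω | ∀ j, ¬ s < ∑ i ∈ Finset.range j, ε i ω} ≤
      Real.exp s * r ^ j := by
    intro j
    have hmgf : mgf (∑ i ∈ Finset.range j, ε i) Pr (-1) = r ^ j := by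
      rw [hindep.mgf_sum hε, Finset.prod_congr rfl (g := fun _ => r) fun i _ => by
        rw [hr, ← hlaw i, mgf_id_map (hε i).aemeasurable], Finset.prod_const, Finset.card_range]
    have hint : Integrable (fun ω => Real.exp (-1 * (∑ i ∈ Finset.range j, ε i) ω)) Pr := by
      refine .of_bound (by fun_prop) 1 (hpos.mono fun ω hω => ?_)
      rw [Real.norm_eq_abs, Real.abs_exp, Real.exp_le_one_iff, Finset.sum_apply]
      have : 0 ≤ ∑ i ∈ Finset.range j, ε i ω := Finset.sum_nonneg fun i _ => (hω i).le
      linarith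
    have h := measure_le_le_exp_mul_mgf s (by norm_num) hint
    rw [hmgf] at h
    refine (measureReal_mono fun ω hω => ?_).trans (h.trans_eq (by norm_num))
    simpa using hω j
  have hlim : Filter.Tendsto (fun j => Real.exp s * r ^ j) Filter.atTop (nhds 0) := by
    simpa using (tendsto_pow_atTop_nhds_zero_of_lt_one hr0 (mgf_neg_one_lt_one hψ)).const_mul
      (Real.exp s)
  have hzero : Pr.real {ω | ∀ j, ¬ s < ∑ i ∈ Finset.range j, ε i ω} = 0 :=
    le_antisymm (ge_of_tendsto' hlim hbound) measureReal_nonneg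
  rw [ae_iff]
  simpa [measureReal_def, ENNReal.toReal_eq_zero_iff] using hzero

instance isProbabilityMeasure_convPower {ψ : Measure ℝ} [IsProbabilityMeasure ψ] (j : ℕ) :
    IsProbabilityMeasure (convPower ψ j) := by
  induction j with
  | zero => exact inferInstanceAs (IsProbabilityMeasure (Measure.dirac (0 : ℝ)))
  | succ j ih => exact inferInstanceAs (IsProbabilityMeasure (convPower ψ j ∗ ψ))

theorem map_sum_eq_convPower (hε : ∀ j, Measurable (ε j)) (hlaw : ∀ j, Pr.map (ε j) = ψ)
    (hindep : iIndepFun ε Pr) (j : ℕ) :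
    Pr.map (∑ i ∈ Finset.range j, ε i) = convPower ψ j := by
  induction j with
  | zero =>
    have : (∑ i ∈ Finset.range 0, ε i) = fun _ => (0 : ℝ) := by simp; rfl
    rw [this, Measure.map_const]
    simp [convPower]
  | succ j ih =>
    rw [Finset.sum_range_succ, (hindep.indepFun_sum_range_succ hε j).map_add_eq_map_conv_map
      (by fun_prop) (hε j), ih, hlaw]
    rfl

/-- The weight of `ψ^{*j}` in the definition of `a` is the probability of `j` renewals by
time `s`. -/
theorem measureReal_counting_eq [IsProbabilityMeasure ψ] (hψ : ψ (Set.Iic 0) = 0)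
    (hε : ∀ j, Measurable (ε j))
    (hlaw : ∀ j, Pr.map (ε j) = ψ) (hindep : iIndepFun ε Pr) {s : ℝ} (hs : 0 ≤ s) (j : ℕ) :
    Pr.real {ω | counting ε s ω = j} =
      ∫ u in Set.Icc 0 s, ψ.real (Set.Ioi (s - u)) ∂(convPower ψ j) := by
  have hpos := ae_pos hψ hε hlaw
  have hSm : Measurable (∑ i ∈ Finset.range j, ε i) := by fun_prop
  set A : Set (ℝ × ℝ) := {x | x.1 ≤ s ∧ s < x.1 + x.2} with hA
  have hAm : MeasurableSet A :=
    (measurableSet_le measurable_fst measurable_const).inter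
      (measurableSet_lt measurable_const (measurable_fst.add measurable_snd))
  have h1 : Pr.real {ω | counting ε s ω = j} =
      Pr.real ((fun ω => ((∑ i ∈ Finset.range j, ε i) ω, ε j ω)) ⁻¹' A) := by
    refine measureReal_congr ?_
    filter_upwards [hpos, ae_exists_lt_sum hψ hε hlaw hindep s] with ω hω hex
    refine propext ((counting_eq_iff hs hω hex j).trans ?_)
    rw [Finset.sum_range_succ]
    change _ ↔ (∑ i ∈ Finset.range j, ε i) ω ≤ s ∧ s < (∑ i ∈ Finset.range j, ε i) ω + ε j ω
    rw [Finset.sum_apply]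
  have hprod := (indepFun_iff_map_prod_eq_prod_map_map hSm.aemeasurable (hε j).aemeasurable).1
    (hindep.indepFun_sum_range_succ hε j)
  have hnn : ∀ᵐ u ∂(convPower ψ j), 0 ≤ u := by
    rw [← map_sum_eq_convPower hε hlaw hindep j,
      ae_map_iff hSm.aemeasurable measurableSet_Ici]
    filter_upwards [hpos] with ω hω
    rw [Finset.sum_apply]
    exact Finset.sum_nonneg fun i _ => (hω i).le
  rw [h1, ← map_measureReal_apply (hSm.prodMk (hε j)) hAm, hprod, hlaw,
    map_sum_eq_convPower hε hlaw hindep j, measureReal_def, Measure.prod_apply hAm,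
    ← integral_toReal (measurable_measure_prodMk_left hAm).aemeasurable
      (Filter.Eventually.of_forall fun _ => measure_lt_top _ _),
    ← integral_indicator measurableSet_Icc]
  refine integral_congr_ae ?_
  filter_upwards [hnn] with u hu
  by_cases hus : u ≤ s
  · rw [Set.indicator_of_mem (Set.mem_Icc.2 ⟨hu, hus⟩), measureReal_def]
    congr 2
    ext x
    simp only [hA, Set.mem_preimage, Set.mem_ofPred_eq, Set.mem_Ioi]
    constructor
    · intro h; linarith [h.2]
    · intro h; exact ⟨hus, by linarith⟩
  · rw [Set.indicator_of_notMem fun h => hus h.2]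
    have : Prod.mk u ⁻¹' A = ∅ := by
      ext x; simp [hA, hus]
    simp [this]

/-- The expectation at time `s` is a mixture of the expectations along the chain, since the number
of renewals is independent of the chain. -/
theorem hasSum_integral_process {S : Type*} [Fintype S] [MeasurableSpace S]
    [MeasurableSingletonClass S] {Z : ℕ → Ω → S} (hZ : ∀ k, Measurable (Z k))
    (hε : ∀ j, Measurable (ε j)) (hZε : IndepFun (fun ω k => Z k ω) (fun ω j => ε j ω) Pr)
    (s : ℝ) (f : S → ℝ) :
    HasSum (fun j => Pr.real {ω | counting ε s ω = j} * ∫ ω, f (Z j ω) ∂Pr)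
      (∫ ω, f (process Z ε s ω) ∂Pr) := by
  have hN := measurable_counting hε s
  have hX : Measurable (process Z ε s) :=
    (measurable_from_prod_countable_right (f := fun x : ℕ × Ω => Z x.1 x.2) hZ).comp
      (hN.prodMk measurable_id)
  have hset : ∀ j, MeasurableSet {ω | counting ε s ω = j} := fun j =>
    hN (measurableSet_singleton j)
  have hU : (⋃ j, {ω | counting ε s ω = j}) = Set.univ := by
    ext ω; simp
  have h := hasSum_integral_iUnion (μ := Pr) (f := fun ω => f (process Z ε s ω)) hset
    (fun i j hij => Set.disjoint_left.2 fun ω hi hj => hij (hi.symm.trans hj))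
    (integrable_of_finite_range hX f).integrableOn
  rw [hU, setIntegral_univ] at h
  have hterm : ∀ j, ∫ ω in {ω | counting ε s ω = j}, f (process Z ε s ω) ∂Pr =
      Pr.real {ω | counting ε s ω = j} * ∫ ω, f (Z j ω) ∂Pr := by
    intro j
    have hind : IndepFun (fun ω => f (Z j ω))
        (fun ω => Set.indicator {ω | counting ε s ω = j} (fun _ => (1 : ℝ)) ω) Pr := by
      -- the counting process at time `s` is a measurable function of the pausing times
      have hg : Measurable (Set.indicator {e : ℕ → ℝ | counting (fun i e => e i) s e = j}
          fun _ => (1 : ℝ)) :=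
        measurable_const.indicator
          (measurable_counting (fun i => measurable_pi_apply i) s (measurableSet_singleton j))
      exact hZε.comp ((Measurable.of_discrete (f := f)).comp (measurable_pi_apply j)) hg
    have hmul : ∀ ω, Set.indicator {ω | counting ε s ω = j} (fun ω => f (Z j ω)) ω =
        f (Z j ω) * Set.indicator {ω | counting ε s ω = j} (fun _ => (1 : ℝ)) ω := by
      intro ω
      by_cases h : ω ∈ {ω | counting ε s ω = j} <;> simp [h]
    rw [setIntegral_congr_fun (hset j) (g := fun ω => f (Z j ω)) fun ω hω => by
        simp only [process, show counting ε s ω = j from hω], ← integral_indicator (hset j)]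
    simp_rw [hmul]
    rw [hind.integral_fun_mul_eq_mul_integral
      ((Measurable.of_discrete (f := f)).comp (hZ j)).aestronglyMeasurable
      (measurable_const.indicator (hset j)).aestronglyMeasurable, mul_comm]
    congr 1
    rw [integral_indicator_const _ (hset j)]
    simp
  simpa only [hterm] using h

/-- Expectation at time `s` of a function that is, up to the constant `b`, an eigenfunction of the
transition matrix. -/
theorem integral_process_of_eigen [IsProbabilityMeasure ψ] (hψ : ψ (Set.Iic 0) = 0)
    {S : Type*} [Fintype S] [MeasurableSpace S] [MeasurableSingletonClass S]
    {Q : Matrix S S ℝ} {Z : ℕ → Ω → S} (hZ : IsMarkovChain Pr Q Z)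
    (hε : ∀ j, Measurable (ε j)) (hlaw : ∀ j, Pr.map (ε j) = ψ) (hindep : iIndepFun ε Pr)
    (hZε : IndepFun (fun ω k => Z k ω) (fun ω j => ε j ω) Pr) {s : ℝ} (hs : 0 ≤ s)
    {f : S → ℝ} {q b : ℝ} (hq : |q| ≤ 1)
    (hf : ∀ x, ∑ y, Q x y * f y = q * f x + (1 - q) * b) :
    ∫ ω, f (process Z ε s ω) ∂Pr =
      (1 - ∑' j : ℕ, q ^ j * ∫ u in Set.Icc 0 s, ψ.real (Set.Ioi (s - u)) ∂(convPower ψ j)) * b +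
        (∑' j : ℕ, q ^ j * ∫ u in Set.Icc 0 s, ψ.real (Set.Ioi (s - u)) ∂(convPower ψ j)) *
          ∫ ω, f (process Z ε 0 ω) ∂Pr := by
  have hstart : ∫ ω, f (process Z ε 0 ω) ∂Pr = ∫ ω, f (Z 0 ω) ∂Pr := by
    refine integral_congr_ae ?_
    filter_upwards [ae_pos hψ hε hlaw] with ω hω
    rw [process, counting_zero (hω 0)]
  simp_rw [hstart, ← measureReal_counting_eq hψ hε hlaw hindep hs]
  set p : ℕ → ℝ := fun j => Pr.real {ω | counting ε s ω = j} with hp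
  have hp1 : HasSum p 1 := by
    simpa using hasSum_integral_process hZ.measurable hε hZε s (fun _ => (1 : ℝ))
  have hqp : Summable fun j => q ^ j * p j := by
    refine Summable.of_norm_bounded hp1.summable fun j => ?_
    rw [norm_mul, norm_pow, Real.norm_eq_abs, Real.norm_of_nonneg measureReal_nonneg]
    exact mul_le_of_le_one_left measureReal_nonneg (pow_le_one₀ (abs_nonneg q) hq)
  have h1 := hasSum_integral_process hZ.measurable hε hZε s f
  have h2 := (hp1.mul_right b).add (hqp.hasSum.mul_right (∫ ω, f (Z 0 ω) ∂Pr - b))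
  have hterm : ∀ j, p j * b + q ^ j * p j * (∫ ω, f (Z 0 ω) ∂Pr - b) =
      p j * ∫ ω, f (Z j ω) ∂Pr := fun j => by
    rw [hZ.integral_eq_of_eigen hf j]
    ring
  simp only [hterm] at h2
  rw [h1.unique h2]
  ring

end Renewal

end ResInd

theorem proposition3p1 {T : Type*} [Group T] [Finite T] {n : ℕ} (hn : 1 ≤ n)
    {Ω : Type*} [MeasurableSpace Ω] (Pr : Measure Ω) [IsProbabilityMeasure Pr]
    -- the pausing time distribution, a probability on `(0, ∞)`
    (ψ : Measure ℝ) [IsProbabilityMeasure ψ] (hψ : ψ (Set.Iic 0) = 0)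
    -- the Res-Ind chain
    (Z : ℕ → Ω → ResInd.MultiDiagram T n) (hZ : ResInd.IsMarkovChain Pr (ResInd.P T n) Z)
    -- the IID pausing times, independent of the chain
    (ε : ℕ → Ω → ℝ) (hε : ∀ j, Measurable (ε j)) (hlaw : ∀ j, Pr.map (ε j) = ψ)
    (hindep : iIndepFun ε Pr)
    (hZε : IndepFun (fun ω k => Z k ω) (fun ω j => ε j ω) Pr)
    {s : ℝ} (hs : 0 ≤ s) (ζ : ResInd.Irr T) :
    ∫ ω, ((ResInd.process Z ε s ω).size ζ : ℝ) / (n : ℝ) ∂Pr =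
      (1 - ResInd.a ψ 1 n s) * ((ζ.dim : ℝ) ^ 2 / (Nat.card T : ℝ)) +
        ResInd.a ψ 1 n s * ∫ ω, ((ResInd.process Z ε 0 ω).size ζ : ℝ) / (n : ℝ) ∂Pr := by
  have : MeasurableSingletonClass (ResInd.MultiDiagram T n) := ⟨fun _ => trivial⟩
  have hn' : (1 : ℝ) ≤ n := by exact_mod_cast hn
  have hq : |1 - 1 / (n : ℝ)| ≤ 1 := by
    have h0 : 0 < 1 / (n : ℝ) := by positivity
    have h1 : 1 / (n : ℝ) ≤ 1 := (div_le_one (by linarith)).2 hn'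
    rw [abs_of_nonneg (by linarith)]
    linarith
  have h := ResInd.integral_process_of_eigen hψ hZ hε hlaw hindep hZε hs hq
    (fun l => ResInd.sum_P_mul_size_div hn l ζ)
  simpa only [ResInd.a, Nat.cast_one] using h
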